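/- **Partitions and Schur functions.** A partition $\lambda=(\lambda_1\ge\lambda_2\ge\dots\ge 0)$ has finitely many non-zero parts, $\lambda'$ denotes its dual, and $\lambda$ is even if all its parts are even. For finitely many nonnegative variables $\rho=(x_1,\dots,x_m)$ let $s_{\lambda/\mu}(\rho)$ be the skew Schur function evaluated at these variables ($0$ unless $\mu\subset\lambda$, and $\mathbf 1_{\lambda=\mu}$ if $m=0$), $s_\lambda=s_{\lambda/\varnothing}$, and $\tau_\lambda(\rho)=\sum_{\kappa:\ \kappa'\text{ even}}s_{\lambda/\kappa}(\rho)$. The *Pfaffian Schur process* $\mathbf{PSP}[\rho_0^+;\dots;\rho_{n-1}^+\,|\,\rho_1^-;\dots;\rho_n^-]$ is the probability measure on sequences of partitions $\varnothing\subset\lambda^{(1)}\supset\mu^{(1)}\subset\lambda^{(2)}\supset\dots\supset\mu^{(n-1)}\subset\lambda^{(n)}\supset\varnothing$ with probabilities proportional to $$\tau_{\lambda^{(1)}}(\rho_0^+)\,\Big(\prod_{k=1}^{n-1}s_{\lambda^{(k)}/\mu^{(k)}}(\rho_k^-)\,s_{\lambda^{(k+1)}/\mu^{(k)}}(\rho_k^+)\Big)\,s_{\lambda^{(n)}}(\rho_n^-).$$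 **Zig-zag paths.** Let $\Omega$ be the set of lattice paths which start on the horizontal axis, go by unit steps to the left or upwards, hit the diagonal at some point $(N,N)$ with $N\ge1$, and then take one last edge from $(N,N)$ to $(0,0)$. Given $\gamma\in\Omega$ whose unit edges $e$ are labelled by finite lists of variables $\rho_e$ and whose diagonal edge is labelled by $\rho_\circ$, the *Pfaffian Schur process indexed by $\gamma$* is the probability measure on families of partitions $(\lambda^v)$ indexed by the vertices $v$ of $\gamma$, with $\lambda^v=\varnothing$ for $v$ on the horizontal axis, with probabilities proportional to $$\tau_{\lambda^{(N,N)}}(\rho_\circ)\prod_{e=(u\to v)\text{ vertical}}s_{\lambda^v/\lambda^u}(\rho_e)\prod_{e=(u\to v)\text{ horizontal}}s_{\lambda^u/\lambda^v}(\rho_e).$$ **Half-space geometric last passage percolation.** Let $c$ and $a_1,a_2,\dots$ be positive real numbers with $a_pa_q<1$ for all $p>q\ge1$ and $c\,a_p<1$ for all $p\ge1$. Let $(g_{p,q})_{p\ge q\ge1}$ be independent random variables with $\mathbb P(g_{p,q}=k)=(1-a_pa_q)(a_pa_q)^k$ for $p>q$ and $\mathbb P(g_{p,p}=k)=(1-ca_p)(ca_p)^k$,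 $k\in\mathbb Z_{\ge0}$. Define $G(p,0)=0$ and, for $p\ge q\ge1$, $G(p,q)=g_{p,q}+\max\{G(p-1,q),G(p,q-1)\}$ if $p>q$ and $G(p,p)=g_{p,p}+G(p,p-1)$. **Proposition.** Let $n\ge1$ and let $0<i_1<\dots<i_n$ and $j_1>\dots>j_n\ge0$ be integers with $i_k\ge j_k$ for all $k$. (a) The normalisation below is positive and finite, and $$\big(G(i_1,j_1),\dots,G(i_n,j_n)\big)\overset{(d)}{=}\big(\lambda^{(1)}_1,\dots,\lambda^{(n)}_1\big),$$ where $(\lambda^{(1)},\dots,\lambda^{(n)})$ is the $\lambda$-marginal of $\mathbf{PSP}[\rho_0^+;\dots;\rho_{n-1}^+\,|\,\rho_1^-;\dots;\rho_n^-]$ with $\rho_0^+=(c,a_{j_1+1},\dots,a_{i_1})$; $\rho_k^+=(a_{i_k+1},\dots,a_{i_{k+1}})$ and $\rho_k^-=(a_{j_{k+1}+1},\dots,a_{j_k})$ for $1\le k\le n-1$; and $\rho_n^-=(a_1,\dots,a_{j_n})$. (b) For every path $\gamma\in\Omega$ passing through $(i_1,j_1),\dots,(i_n,j_n)$, the Pfaffian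 Schur process indexed by $\gamma$, in which each vertical edge $(p,q-1)\to(p,q)$ is labelled by the single variable $a_q$, each horizontal edge $(p,q)\to(p-1,q)$ by the single variable $a_p$, and the diagonal edge by the single variable $c$, is well defined (positive finite normalisation), and $$\big(G(i_1,j_1),\dots,G(i_n,j_n)\big)\overset{(d)}{=}\big(\lambda^{(i_1,j_1)}_1,\dots,\lambda^{(i_n,j_n)}_1\big).$$ -/

import Mathlib

open MeasureTheory ProbabilityTheory
open scoped ENNReal NNReal

/-- Partitions are Young diagrams: `l.rowLen r` is the part `λ_{r+1}`, `≤` is containment, `⊥` is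
the empty partition, `l.card` is the number of boxes `|λ|`, `l.transpose` is the dual `λ'`. -/
instance : MeasurableSpace YoungDiagram := ⊤

/-- A partition is even if all its parts are even. -/
def YoungDiagram.IsEven (l : YoungDiagram) : Prop := ∀ r, Even (l.rowLen r)

/-- `m ≺ l`: `λ_r ≥ μ_r ≥ λ_{r+1}` for all `r`, that is, `λ / μ` is a horizontal strip. -/
def YoungDiagram.Interlaces (m l : YoungDiagram) : Prop :=
  ∀ r, m.rowLen r ≤ l.rowLen r ∧ l.rowLen (r + 1) ≤ m.rowLen r

/-- A (semistandard, or column-strict) skew tableau of shape `l / m` with entries in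
`{1, …, k}`, given by its increasing sequence of shapes
`m = λ⁽⁰⁾ ≺ λ⁽¹⁾ ≺ ⋯ ≺ λ⁽ᵏ⁾ = l`; the entries equal to `r` fill the horizontal strip
`λ⁽ʳ⁾ / λ⁽ʳ⁻¹⁾`. -/
structure SkewTableau (k : ℕ) (l m : YoungDiagram) where
  shape : Fin (k + 1) → YoungDiagram
  shape_zero : shape 0 = m
  shape_last : shape (Fin.last k) = l
  interlaces : ∀ r : Fin k, (shape r.castSucc).Interlaces (shape r.succ)

/-- The skew Schur function `s_{l / m}(x₁, …, x_k) = ∑_T x^T`, the sum being over the skew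
tableaux `T` of shape `l / m`, evaluated at finitely many nonnegative variables. It vanishes unless
`m ⊆ l`, and is the indicator of `l = m` for the empty list of variables. -/
noncomputable def skewSchur (x : List ℝ≥0) (l m : YoungDiagram) : ℝ≥0∞ :=
  ∑' T : SkewTableau x.length l m,
    ∏ r : Fin x.length,
      ((x.get r : ℝ≥0) : ℝ≥0∞) ^ ((T.shape r.succ).card - (T.shape r.castSucc).card)

/-- `τ_l = ∑_{κ' even} s_{l / κ}`. -/
noncomputable def tauSchur (x : List ℝ≥0) (l : YoungDiagram) : ℝ≥0∞ :=
  ∑' κ : {κ : YoungDiagram // κ.transpose.IsEven}, skewSchur x l κ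

/-- The measure giving mass `w x / ∑_y w y` to each point `x`. -/
noncomputable def normalizedMeasure {X : Type*} [MeasurableSpace X] (w : X → ℝ≥0∞) :
    Measure X :=
  (∑' x, w x)⁻¹ • Measure.sum (fun x => w x • Measure.dirac x)

/-- The weight of the sequence `∅ ⊆ λ⁽¹⁾ ⊇ μ⁽¹⁾ ⊆ λ⁽²⁾ ⊇ ⋯ ⊇ μ⁽ⁿ⁾ ⊆ λ⁽ⁿ⁺¹⁾ ⊇ ∅`. Here
`ρp = (ρ⁺_0, …, ρ⁺_n)`, `ρm = (ρ⁻_1, …, ρ⁻_{n+1})`, `lam = (λ⁽¹⁾, …, λ⁽ⁿ⁺¹⁾)`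
and `mu = (μ⁽¹⁾, …, μ⁽ⁿ⁾)`. -/
noncomputable def pfaffianSchurWeight {n : ℕ} (ρp ρm : Fin (n + 1) → List ℝ≥0)
    (s : (Fin (n + 1) → YoungDiagram) × (Fin n → YoungDiagram)) : ℝ≥0∞ :=
  tauSchur (ρp 0) (s.1 0) *
    (∏ k : Fin n, skewSchur (ρm k.castSucc) (s.1 k.castSucc) (s.2 k) *
      skewSchur (ρp k.succ) (s.1 k.succ) (s.2 k)) *
    skewSchur (ρm (Fin.last n)) (s.1 (Fin.last n)) ⊥

/-- The Pfaffian Schur process `PSP[ρ⁺_0; …; ρ⁺_n | ρ⁻_1; …; ρ⁻_{n+1}]`, as the law of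
`(λ, μ)`. -/
noncomputable def pfaffianSchurLaw {n : ℕ} (ρp ρm : Fin (n + 1) → List ℝ≥0) :
    Measure ((Fin (n + 1) → YoungDiagram) × (Fin n → YoungDiagram)) :=
  normalizedMeasure (pfaffianSchurWeight ρp ρm)

/-- A zig-zag path in the half-quadrant: it starts on the horizontal axis, proceeds by unit steps
to the left or upwards, and hits the diagonal at `(size, size)`, from where it takes one final edge
to the origin. The part of the path on the axis to the right of `vertex 0`, and the origin,
carry empty partitions only and are left implicit. -/
structure ZigZagPath where
  len : ℕ
  vertex : Fin (len + 1) → ℕ × ℕ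
  size : ℕ
  size_pos : 0 < size
  start : (vertex 0).2 = 0
  finish : vertex (Fin.last len) = (size, size)
  step : ∀ t : Fin len,
    ((vertex t.castSucc).1 = (vertex t.succ).1 + 1 ∧ (vertex t.castSucc).2 = (vertex t.succ).2) ∨
    ((vertex t.succ).1 = (vertex t.castSucc).1 ∧ (vertex t.succ).2 = (vertex t.castSucc).2 + 1)

namespace ZigZagPath

/-- The edge `vertex t → vertex (t + 1)` is vertical (otherwise it is horizontal). -/
abbrev IsUp (γ : ZigZagPath) (t : Fin γ.len) : Prop :=
  (γ.vertex t.succ).2 = (γ.vertex t.castSucc).2 + 1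

/-- The weight of the edge `u → v`: `s_{λ^v / λ^u}` for a vertical edge and `s_{λ^u / λ^v}` for
a horizontal edge. -/
noncomputable def edgeWeight (γ : ZigZagPath) (ρ : Fin γ.len → List ℝ≥0)
    (lam : Fin (γ.len + 1) → YoungDiagram) (t : Fin γ.len) : ℝ≥0∞ :=
  if γ.IsUp t then skewSchur (ρ t) (lam t.succ) (lam t.castSucc)
  else skewSchur (ρ t) (lam t.castSucc) (lam t.succ)

open Classical in
/-- The weight of a family of partitions indexed by the vertices of the path; the partitions on
the horizontal axis have to be empty. `ρ₀` labels the diagonal edge. -/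
noncomputable def weight (γ : ZigZagPath) (ρ₀ : List ℝ≥0) (ρ : Fin γ.len → List ℝ≥0)
    (lam : Fin (γ.len + 1) → YoungDiagram) : ℝ≥0∞ :=
  if ∀ t, (γ.vertex t).2 = 0 → lam t = ⊥ then
    tauSchur ρ₀ (lam (Fin.last γ.len)) * ∏ t : Fin γ.len, γ.edgeWeight ρ lam t
  else 0

/-- The Pfaffian Schur process indexed by a zig-zag path with labelled edges. -/
noncomputable def pfaffianSchurLaw (γ : ZigZagPath) (ρ₀ : List ℝ≥0)
    (ρ : Fin γ.len → List ℝ≥0) : Measure (Fin (γ.len + 1) → YoungDiagram) :=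
  normalizedMeasure (γ.weight ρ₀ ρ)

/-- The labels by single variables: the vertical edge `(p, q - 1) → (p, q)` is labelled by `a q`,
the horizontal edge `(p, q) → (p - 1, q)` by `a p`. -/
def label (γ : ZigZagPath) (a : ℕ → ℝ≥0) (t : Fin γ.len) : List ℝ≥0 :=
  if γ.IsUp t then [a (γ.vertex t.succ).2] else [a (γ.vertex t.castSucc).1]

end ZigZagPath

/-- The list of variables `(a_{p+1}, …, a_q)`, empty if `q ≤ p`. -/
def varsIoc (a : ℕ → ℝ≥0) (p q : ℕ) : List ℝ≥0 := (List.Ico (p + 1) (q + 1)).map a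

/-- `ρ⁺_0 = (c, a_{j₁+1}, …, a_{i₁})` and `ρ⁺_k = (a_{i_k+1}, …, a_{i_{k+1}})`; the indices
of `i` and `j` are shifted down by one. -/
def lppRhoPlus (a : ℕ → ℝ≥0) (c : ℝ≥0) {n : ℕ} (i j : Fin (n + 1) → ℕ) :
    Fin (n + 1) → List ℝ≥0 :=
  Fin.cons (α := fun _ => List ℝ≥0) (c :: varsIoc a (j 0) (i 0))
    (fun k : Fin n => varsIoc a (i k.castSucc) (i k.succ))

/-- `ρ⁻_k = (a_{j_{k+1}+1}, …, a_{j_k})`, and the last one is `(a_1, …, a_{j_{n+1}})`. -/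
def lppRhoMinus (a : ℕ → ℝ≥0) {n : ℕ} (j : Fin (n + 1) → ℕ) : Fin (n + 1) → List ℝ≥0 :=
  Fin.snoc (α := fun _ => List ℝ≥0)
    (fun k : Fin n => varsIoc a (j k.succ) (j k.castSucc))
    (varsIoc a 0 (j (Fin.last n)))

/-- `X ∼ Geom(q)` under `P`, that is, `P(X = k) = (1 - q) q^k` for `k = 0, 1, 2, …`. -/
def IsGeometric {Ω : Type*} [MeasurableSpace Ω] (P : Measure Ω) (X : Ω → ℕ) (q : ℝ) : Prop :=
  Measurable X ∧ ∀ k : ℕ, P (X ⁻¹' {k}) = ENNReal.ofReal ((1 - q) * q ^ k)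

/-- Half-space last passage times `G(n, m)`, `n ≥ m ≥ 0`, with weights `g n m`, `n ≥ m ≥ 1`
(the values for `n < m` are irrelevant). -/
def lastPassage (g : ℕ → ℕ → ℕ) : ℕ → ℕ → ℕ
  | _, 0 => 0
  | 0, _ + 1 => 0
  | n + 1, m + 1 =>
    g (n + 1) (m + 1) +
      if m + 1 ≤ n then max (lastPassage g n (m + 1)) (lastPassage g (n + 1) m)
      else lastPassage g (n + 1) m
  termination_by n m => n + m

/-! A single local move drives the proof. At an outer corner (p, q) of a path, with neighbouring
partitions l and m, fix everything except the corner partition κ. The local growth rule is a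
bijection between the κ interlacing above l and m and the pairs (k, ν) with ν interlacing below
both; under it κ₁ = max(l₁, m₁) + k and |κ| + |ν| = k + |l| + |m|. Hence summing a test function of
κ₁ over κ gives the corresponding sum for the path with the corner pushed in, with κ₁ replaced by
max(l₁, m₁) + k and k weighted by (a_p a_q)^k (`tsum_skewSchur_mul_skewSchur`). This is the
recursion for G, with k in the role of the geometric weight at (p, q). At the diagonal l = m, and τ
of the single variable c is c to the alternating sum of the parts; growth raises that sum by k,
which produces (c a_p)^k (`tsum_tauSchur_mul_skewSchur`).

The passage times along the pushed-in path do not use the weight at (p, q), so independence matches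
the two recursions. Induction on the area under the path, down to the path on the axis with only
empty partitions, gives `tsum_heightWeight`: sums of test functions of the first rows are Z times
expectations of the same functions of the passage times, with 0 < Z < ∞. Finiteness of the
normalisation comes for free, and (b) follows.

For (a), take the path with corners at the given points. Summing out the vertices inside straight
segments merges single variables into lists by the branching rule; the λ survive at the given points
and the μ at the inner corners between them (`tsum_pfaffianSchurWeight`). -/

namespace YoungDiagram

/-! ### Young diagrams and interlacing through row lengths -/

theorem ext_rowLen {l m : YoungDiagram} (h : ∀ r, l.rowLen r = m.rowLen r) : l = m := by
  refine SetLike.ext fun ⟨i, j⟩ => ?_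
  rw [mem_iff_lt_rowLen, mem_iff_lt_rowLen, h]

/-- The Young diagram with the given row lengths. -/
def ofAntitone (f : ℕ → ℕ) (hf : Antitone f) (N : ℕ) (_ : f N = 0) : YoungDiagram where
  cells := (Finset.range N ×ˢ Finset.range (f 0)).filter fun c => c.2 < f c.1
  isLowerSet := by
    rintro ⟨i, j⟩ ⟨i', j'⟩ ⟨h₁, h₂⟩ h
    simp only [Finset.coe_filter, Finset.mem_product, Finset.mem_range, Set.mem_ofPred_eq] at h ⊢
    simp only at h₁ h₂
    have := hf h₁
    omega

theorem rowLen_ofAntitone (f : ℕ → ℕ) (hf : Antitone f) (N : ℕ) (hN : f N = 0) (r : ℕ) :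
    (ofAntitone f hf N hN).rowLen r = f r := by
  have key : ∀ j, j < (ofAntitone f hf N hN).rowLen r ↔ j < f r := by
    intro j
    rw [← mem_iff_lt_rowLen, ← mem_cells]
    simp only [ofAntitone, Finset.mem_filter, Finset.mem_product, Finset.mem_range]
    refine ⟨fun h => h.2, fun h => ⟨⟨?_, h.trans_le (hf (Nat.zero_le r))⟩, h⟩⟩
    by_contra hr
    have := hf (not_lt.1 hr)
    omega
  exact le_antisymm (le_of_not_gt fun h => lt_irrefl _ ((key _).1 h))
    (le_of_not_gt fun h => lt_irrefl _ ((key _).2 h))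

theorem rowLen_eq_zero_of_le {l : YoungDiagram} {N r : ℕ} (h : l.rowLen N = 0) (hr : N ≤ r) :
    l.rowLen r = 0 :=
  Nat.eq_zero_of_le_zero (h ▸ l.rowLen_anti N r hr)

theorem rowLen_colLen_zero (l : YoungDiagram) : l.rowLen (l.colLen 0) = 0 := by
  by_contra h
  exact lt_irrefl _ (mem_iff_lt_colLen.1 (mem_iff_lt_rowLen.2 (Nat.pos_of_ne_zero h)))

theorem card_eq_sum_rowLen (l : YoungDiagram) {N : ℕ} (h : l.rowLen N = 0) :
    l.card = ∑ r ∈ Finset.range N, l.rowLen r := by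
  rw [YoungDiagram.card, Finset.card_eq_sum_card_fiberwise (f := Prod.fst) (t := Finset.range N)]
  · refine Finset.sum_congr rfl fun r _ => ?_
    rw [rowLen_eq_card]; rfl
  · rintro ⟨i, j⟩ hc
    have := mem_iff_lt_rowLen.1 ((mem_cells _).1 hc)
    refine Finset.mem_coe.2 (Finset.mem_range.2 (lt_of_not_ge fun hi => ?_))
    have h₀ : l.rowLen i = 0 := rowLen_eq_zero_of_le h hi
    omega

@[simp] theorem rowLen_bot (r : ℕ) : (⊥ : YoungDiagram).rowLen r = 0 := by
  by_contra h
  exact notMem_bot _ (mem_iff_lt_rowLen.2 (Nat.pos_of_ne_zero h))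

theorem card_bot : (⊥ : YoungDiagram).card = 0 := rfl

theorem exists_rowLen_eq_zero (l m : YoungDiagram) :
    ∃ N, l.rowLen N = 0 ∧ m.rowLen N = 0 :=
  ⟨max (l.colLen 0) (m.colLen 0),
    rowLen_eq_zero_of_le l.rowLen_colLen_zero (le_max_left _ _),
    rowLen_eq_zero_of_le m.rowLen_colLen_zero (le_max_right _ _)⟩

namespace Interlaces

variable {l m : YoungDiagram}

theorem le (h : m.Interlaces l) : m ≤ l := by
  rintro ⟨i, j⟩ hc
  exact mem_iff_lt_rowLen.2 ((mem_iff_lt_rowLen.1 hc).trans_le (h i).1)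

theorem card_le (h : m.Interlaces l) : m.card ≤ l.card :=
  Finset.card_le_card (cells_subset_iff.2 h.le)

theorem refl (l : YoungDiagram) : l.Interlaces l :=
  fun r => ⟨le_rfl, l.rowLen_anti _ _ (Nat.le_succ r)⟩

theorem eq_bot (h : m.Interlaces ⊥) : m = ⊥ := le_bot_iff.1 h.le

end Interlaces

/-! ### The local growth bijection -/

/-- The local growth rule: the diagram `κ` above `l` and `m` attached to `ν` below `l` and `m`. -/
def growth (l m ν : YoungDiagram) (k : ℕ) (h₁ : ν.Interlaces l) (h₂ : ν.Interlaces m) :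
    YoungDiagram :=
  ofAntitone
    (fun r => match r with
      | 0 => max (l.rowLen 0) (m.rowLen 0) + k
      -- The truncated subtraction is exact, since ν_r ≤ min(l_r, m_r) by interlacing.
      | r + 1 => max (l.rowLen (r + 1)) (m.rowLen (r + 1)) + min (l.rowLen r) (m.rowLen r)
          - ν.rowLen r)
    (by
      refine antitone_nat_of_succ_le fun r => ?_
      cases r with
      | zero =>
        have := h₁ 0; have := h₂ 0
        simp only
        omega
      | succ r =>
        have := h₁ r; have := h₂ r
        have := h₁ (r + 1); have := h₂ (r + 1)
        simp only
        omega)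
    (max (l.colLen 0) (m.colLen 0) + 1)
    (by
      have h₃ := rowLen_eq_zero_of_le l.rowLen_colLen_zero
        (le_max_left (l.colLen 0) (m.colLen 0))
      have h₄ := rowLen_eq_zero_of_le m.rowLen_colLen_zero
        (le_max_right (l.colLen 0) (m.colLen 0))
      have h₅ := rowLen_eq_zero_of_le h₃ (Nat.le_succ _)
      have h₆ := rowLen_eq_zero_of_le h₄ (Nat.le_succ _)
      simp [h₃, h₅, h₆])

/-- The inverse of the local growth rule. -/
def shrink (l m κ : YoungDiagram) (h₁ : l.Interlaces κ) (h₂ : m.Interlaces κ) : YoungDiagram :=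
  ofAntitone
    (fun r => max (l.rowLen (r + 1)) (m.rowLen (r + 1)) + min (l.rowLen r) (m.rowLen r)
      - κ.rowLen (r + 1))
    (by
      refine antitone_nat_of_succ_le fun r => ?_
      have := h₁ r; have := h₂ r
      have := h₁ (r + 1); have := h₂ (r + 1)
      have := h₁ (r + 1 + 1); have := h₂ (r + 1 + 1)
      omega)
    (max (l.colLen 0) (m.colLen 0))
    (by
      have h₃ := rowLen_eq_zero_of_le l.rowLen_colLen_zero
        (le_max_left (l.colLen 0) (m.colLen 0))
      have h₄ := rowLen_eq_zero_of_le m.rowLen_colLen_zero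
        (le_max_right (l.colLen 0) (m.colLen 0))
      have h₅ := rowLen_eq_zero_of_le h₃ (Nat.le_succ _)
      have h₆ := rowLen_eq_zero_of_le h₄ (Nat.le_succ _)
      simp [h₃, h₅, h₆])

section growth

variable {l m ν κ : YoungDiagram}

theorem rowLen_growth_zero (k : ℕ) (h₁ : ν.Interlaces l) (h₂ : ν.Interlaces m) :
    (growth l m ν k h₁ h₂).rowLen 0 = max (l.rowLen 0) (m.rowLen 0) + k := by
  rw [growth, rowLen_ofAntitone]

theorem rowLen_growth_succ (k : ℕ) (h₁ : ν.Interlaces l) (h₂ : ν.Interlaces m) (r : ℕ) :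
    (growth l m ν k h₁ h₂).rowLen (r + 1) =
      max (l.rowLen (r + 1)) (m.rowLen (r + 1)) + min (l.rowLen r) (m.rowLen r)
        - ν.rowLen r := by
  rw [growth, rowLen_ofAntitone]

theorem rowLen_shrink (h₁ : l.Interlaces κ) (h₂ : m.Interlaces κ) (r : ℕ) :
    (shrink l m κ h₁ h₂).rowLen r =
      max (l.rowLen (r + 1)) (m.rowLen (r + 1)) + min (l.rowLen r) (m.rowLen r)
        - κ.rowLen (r + 1) := by
  rw [shrink, rowLen_ofAntitone]

theorem interlaces_growth (k : ℕ) (h₁ : ν.Interlaces l) (h₂ : ν.Interlaces m) :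
    l.Interlaces (growth l m ν k h₁ h₂) ∧ m.Interlaces (growth l m ν k h₁ h₂) := by
  have key : ∀ r, max (l.rowLen r) (m.rowLen r) ≤ (growth l m ν k h₁ h₂).rowLen r ∧
      (growth l m ν k h₁ h₂).rowLen (r + 1) ≤ min (l.rowLen r) (m.rowLen r) := by
    intro r
    have := h₁ r; have := h₂ r
    rw [rowLen_growth_succ]
    cases r with
    | zero => rw [rowLen_growth_zero]; omega
    | succ r =>
      have := h₁ r; have := h₂ r
      rw [rowLen_growth_succ]; omega
  constructor <;> intro r <;> have := key r <;> omega

theorem interlaces_shrink (h₁ : l.Interlaces κ) (h₂ : m.Interlaces κ) :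
    (shrink l m κ h₁ h₂).Interlaces l ∧ (shrink l m κ h₁ h₂).Interlaces m := by
  have key : ∀ r, (shrink l m κ h₁ h₂).rowLen r ≤ min (l.rowLen r) (m.rowLen r) ∧
      max (l.rowLen (r + 1)) (m.rowLen (r + 1)) ≤ (shrink l m κ h₁ h₂).rowLen r := by
    intro r
    have := h₁ r; have := h₂ r; have := h₁ (r + 1); have := h₂ (r + 1)
    rw [rowLen_shrink]; omega
  constructor <;> intro r <;> have := key r <;> omega

/-- The local growth bijection. -/
def growthEquiv (l m : YoungDiagram) :
    {κ : YoungDiagram // l.Interlaces κ ∧ m.Interlaces κ} ≃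
      ℕ × {ν : YoungDiagram // ν.Interlaces l ∧ ν.Interlaces m} where
  toFun κ := (κ.1.rowLen 0 - max (l.rowLen 0) (m.rowLen 0),
    ⟨shrink l m κ.1 κ.2.1 κ.2.2, interlaces_shrink κ.2.1 κ.2.2⟩)
  invFun p := ⟨growth l m p.2.1 p.1 p.2.2.1 p.2.2.2, interlaces_growth p.1 p.2.2.1 p.2.2.2⟩
  left_inv := by
    rintro ⟨κ, h₁, h₂⟩
    refine Subtype.ext (ext_rowLen fun r => ?_)
    cases r with
    | zero =>
      have := h₁ 0; have := h₂ 0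
      simp only [rowLen_growth_zero]; omega
    | succ r =>
      have := h₁ r; have := h₂ r; have := h₁ (r + 1); have := h₂ (r + 1)
      simp only [rowLen_growth_succ, rowLen_shrink]; omega
  right_inv := by
    rintro ⟨k, ν, h₁, h₂⟩
    refine Prod.ext ?_ (Subtype.ext (ext_rowLen fun r => ?_))
    · simp only [rowLen_growth_zero]; omega
    · have := h₁ r; have := h₂ r
      simp only [rowLen_growth_succ, rowLen_shrink]; omega

theorem rowLen_growth_eq_zero (k : ℕ) (h₁ : ν.Interlaces l) (h₂ : ν.Interlaces m) {N : ℕ}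
    (hl : l.rowLen N = 0) (hm : m.rowLen N = 0) :
    (growth l m ν k h₁ h₂).rowLen (N + 1) = 0 := by
  have := rowLen_eq_zero_of_le hl (Nat.le_succ N)
  have := rowLen_eq_zero_of_le hm (Nat.le_succ N)
  simp_all [rowLen_growth_succ]

/-- Since max + min = l + m in each row, the row sums telescope; the partial sums in `key` leave the
extra term max(l_n, m_n), which vanishes at n = N. -/
theorem card_growth (k : ℕ) (h₁ : ν.Interlaces l) (h₂ : ν.Interlaces m) :
    (growth l m ν k h₁ h₂).card + ν.card = k + l.card + m.card := by
  obtain ⟨N, hl, hm⟩ := exists_rowLen_eq_zero l m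
  have hν : ν.rowLen N = 0 := by have := (h₁ N).1; omega
  rw [card_eq_sum_rowLen _ (rowLen_growth_eq_zero k h₁ h₂ hl hm), card_eq_sum_rowLen _ hν,
    card_eq_sum_rowLen _ hl, card_eq_sum_rowLen _ hm]
  clear hν
  have key : ∀ n, ∑ r ∈ Finset.range (n + 1), (growth l m ν k h₁ h₂).rowLen r +
      ∑ r ∈ Finset.range n, ν.rowLen r =
      k + ∑ r ∈ Finset.range n, l.rowLen r + ∑ r ∈ Finset.range n, m.rowLen r +
        max (l.rowLen n) (m.rowLen n) := by
    intro n
    induction n with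
    | zero => simp [rowLen_growth_zero]; omega
    | succ n ih =>
      rw [Finset.sum_range_succ _ (n + 1), rowLen_growth_succ]
      simp only [Finset.sum_range_succ _ n] at ih ⊢
      have := h₁ n; have := h₂ n
      omega
  rw [key, hl, hm]; simp

/-- The alternating sum of the parts. -/
def altSum (l : YoungDiagram) : ℤ := ∑ r ∈ Finset.range (l.colLen 0), (-1) ^ r * (l.rowLen r : ℤ)

theorem altSum_eq (l : YoungDiagram) {N : ℕ} (h : l.rowLen N = 0) :
    l.altSum = ∑ r ∈ Finset.range N, (-1) ^ r * (l.rowLen r : ℤ) := by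
  have hle : l.colLen 0 ≤ N := by
    by_contra hN
    have := mem_iff_lt_rowLen.1 (mem_iff_lt_colLen.2 (not_le.1 hN))
    omega
  rw [altSum]
  refine Finset.sum_subset (Finset.range_mono hle) fun r _ hr => ?_
  have := rowLen_eq_zero_of_le l.rowLen_colLen_zero (not_lt.1 (mt Finset.mem_range.2 hr))
  simp [this]

/-- For l = m, row r + 1 of the grown diagram is m_{r+1} + m_r - ν_r: the parts of m cancel in the
alternating sum, and the sign of ν_r is restored by the shift of rows. This supplies the power of c
in the boundary Cauchy identity. -/
theorem altSum_growth (k : ℕ) (h : ν.Interlaces m) :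
    (growth m m ν k h h).altSum = k + ν.altSum := by
  have hm := m.rowLen_colLen_zero
  set N := m.colLen 0
  have hν : ν.rowLen N = 0 := by have := (h N).1; omega
  rw [altSum_eq _ (rowLen_growth_eq_zero k h h hm hm), altSum_eq _ hν]
  have key : ∀ n, ∑ r ∈ Finset.range (n + 1), (-1) ^ r * ((growth m m ν k h h).rowLen r : ℤ) =
      k + ∑ r ∈ Finset.range n, (-1) ^ r * (ν.rowLen r : ℤ) + (-1) ^ n * (m.rowLen n : ℤ) := by
    intro n
    induction n with
    | zero => simp [rowLen_growth_zero]; ring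
    | succ n ih =>
      rw [Finset.sum_range_succ, ih, Finset.sum_range_succ, rowLen_growth_succ, max_self, min_self]
      have := (h n).1
      have := (h n).2
      rw [Nat.cast_sub (by omega), Nat.cast_add]
      ring
  rw [key, hm]; simp

end growth

/-! ### Diagrams with even columns -/

/-- The unique diagram with columns of even length which interlaces with `l`. -/
def evenCore (l : YoungDiagram) : YoungDiagram :=
  ofAntitone (fun r => l.rowLen (2 * (r / 2) + 1))
    (fun _ _ h => l.rowLen_anti _ _ (by have := Nat.div_le_div_right (c := 2) h; omega))
    (2 * l.colLen 0) (rowLen_eq_zero_of_le l.rowLen_colLen_zero (by omega))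

theorem rowLen_evenCore (l : YoungDiagram) (r : ℕ) :
    l.evenCore.rowLen r = l.rowLen (2 * (r / 2) + 1) :=
  rowLen_ofAntitone ..

/-- A column of odd length 2s + 1 exists exactly when row 2s is strictly longer than row 2s + 1
(rows numbered from 0). -/
theorem isEven_transpose_iff (l : YoungDiagram) :
    l.transpose.IsEven ↔ ∀ r, l.rowLen (2 * r) = l.rowLen (2 * r + 1) := by
  simp only [IsEven, rowLen_transpose]
  constructor
  · intro h r
    refine le_antisymm (le_of_not_gt fun hlt => ?_) (l.rowLen_anti _ _ (Nat.le_succ _))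
    have h₁ := mem_iff_lt_colLen.1 (mem_iff_lt_rowLen.2 hlt)
    have h₂ := mt (mem_iff_lt_colLen (μ := l) (i := 2 * r + 1) (j := l.rowLen (2 * r + 1))).2
      (by rw [mem_iff_lt_rowLen]; omega)
    obtain ⟨s, hs⟩ := h (l.rowLen (2 * r + 1))
    omega
  · intro h j
    by_contra hodd
    obtain ⟨s, hs⟩ := Nat.not_even_iff_odd.1 hodd
    have h₁ := mem_iff_lt_rowLen.1
      (mem_iff_lt_colLen.2 (show 2 * s < l.colLen j by omega))
    have h₂ := mt (mem_iff_lt_rowLen (μ := l) (i := 2 * s + 1) (j := j)).2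
      (by rw [mem_iff_lt_colLen]; omega)
    have := h s
    omega

theorem evenCore_isEven (l : YoungDiagram) : l.evenCore.transpose.IsEven := by
  rw [isEven_transpose_iff]
  intro r
  rw [rowLen_evenCore, rowLen_evenCore]
  congr 1; omega

theorem evenCore_interlaces (l : YoungDiagram) : l.evenCore.Interlaces l := by
  intro r
  rw [rowLen_evenCore]
  rcases Nat.even_or_odd' r with ⟨s, rfl | rfl⟩
  · have h : 2 * (2 * s / 2) + 1 = 2 * s + 1 := by omega
    rw [h]
    exact ⟨l.rowLen_anti _ _ (Nat.le_succ _), le_rfl⟩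
  · have h : 2 * ((2 * s + 1) / 2) + 1 = 2 * s + 1 := by omega
    rw [h]
    exact ⟨le_rfl, l.rowLen_anti _ _ (Nat.le_succ _)⟩

/-- Interlacing gives κ_{2s+1} ≤ l_{2s+1} ≤ κ_{2s}, and the outer two agree when the columns of κ
are even. So the sum defining τ of one variable has a single nonzero candidate. -/
theorem eq_evenCore {l κ : YoungDiagram} (hκ : κ.transpose.IsEven) (h : κ.Interlaces l) :
    κ = l.evenCore := by
  rw [isEven_transpose_iff] at hκ
  refine ext_rowLen fun r => ?_
  rw [rowLen_evenCore]
  rcases Nat.even_or_odd' r with ⟨s, rfl | rfl⟩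
  · have h' : 2 * (2 * s / 2) + 1 = 2 * s + 1 := by omega
    have h₁ := h (2 * s); have h₂ := h (2 * s + 1); have h₃ := hκ s
    rw [h']; omega
  · have h' : 2 * ((2 * s + 1) / 2) + 1 = 2 * s + 1 := by omega
    have h₁ := h (2 * s); have h₂ := h (2 * s + 1); have h₃ := hκ s
    rw [h']; omega

/-- The pair of rows 2s, 2s + 1 contributes l_{2s} + l_{2s+1} - 2 l_{2s+1} = l_{2s} - l_{2s+1}. -/
theorem card_sub_card_evenCore (l : YoungDiagram) :
    ((l.card - l.evenCore.card : ℕ) : ℤ) = l.altSum := by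
  rw [Nat.cast_sub l.evenCore_interlaces.card_le]
  have hl : l.rowLen (2 * l.colLen 0) = 0 :=
    rowLen_eq_zero_of_le l.rowLen_colLen_zero (by omega)
  have he : l.evenCore.rowLen (2 * l.colLen 0) = 0 := by
    have := (l.evenCore_interlaces (2 * l.colLen 0)).1; omega
  rw [card_eq_sum_rowLen _ hl, card_eq_sum_rowLen _ he, altSum_eq _ hl]
  push_cast
  rw [← Finset.sum_sub_distrib]
  generalize l.colLen 0 = N
  induction N with
  | zero => simp
  | succ n ih =>
    rw [show 2 * (n + 1) = 2 * n + 1 + 1 by ring]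
    simp only [Finset.sum_range_succ _ (2 * n), Finset.sum_range_succ _ (2 * n + 1), ih]
    simp only [rowLen_evenCore]
    rw [show 2 * (2 * n / 2) + 1 = 2 * n + 1 by omega,
      show 2 * ((2 * n + 1) / 2) + 1 = 2 * n + 1 by omega]
    simp [pow_succ, pow_mul]
    ring

end YoungDiagram

/-! ### Skew Schur functions: one variable and the branching rule -/

theorem ENNReal.tsum_ite_eq_tsum_subtype {α : Type*} (p : α → Prop) [DecidablePred p] (F : α → ℝ≥0∞) :
    ∑' i, (if p i then F i else 0) = ∑' i : {i // p i}, F i := by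
  refine Eq.trans (tsum_congr fun i => ?_) (tsum_subtype {i | p i} F).symm
  simp only [Set.indicator_apply, Set.mem_ofPred_eq]

namespace SkewTableau

theorem ext' {k : ℕ} {l m : YoungDiagram} {S T : SkewTableau k l m} (h : S.shape = T.shape) :
    S = T := by
  cases S; cases T; congr

/-- A tableau with entries at most `k + 1` is given by the shape `κ` of its entries equal to `1`
and a tableau with entries at most `k` above `κ`. -/
def consEquiv (k : ℕ) (l m : YoungDiagram) :
    SkewTableau (k + 1) l m ≃
      Σ κ : {κ : YoungDiagram // m.Interlaces κ}, SkewTableau k l κ where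
  toFun T := ⟨⟨T.shape 1, by
      have := T.interlaces 0
      rwa [Fin.castSucc_zero, T.shape_zero] at this⟩,
    { shape := fun r => T.shape r.succ
      shape_zero := rfl
      shape_last := T.shape_last
      interlaces := fun r => T.interlaces r.succ }⟩
  invFun p :=
    { shape := Fin.cons m p.2.shape
      shape_zero := rfl
      shape_last := p.2.shape_last
      interlaces := fun r => by
        refine Fin.cases ?_ (fun r => ?_) r
        · have := p.1.2
          rw [← p.2.shape_zero] at this
          exact this
        · exact p.2.interlaces r }
  left_inv T := by
    refine ext' (funext fun r => Fin.cases ?_ (fun r => ?_) r)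
    · exact T.shape_zero.symm
    · rfl
  right_inv := by
    rintro ⟨⟨κ, hκ⟩, ⟨shape, h₀, h₁, h₂⟩⟩
    obtain rfl : shape 0 = κ := h₀
    rfl

end SkewTableau

open Classical in
theorem skewSchur_nil (l m : YoungDiagram) : skewSchur [] l m = if l = m then 1 else 0 := by
  rw [skewSchur]
  split_ifs with h
  · subst h
    let T : SkewTableau ([] : List ℝ≥0).length l l := ⟨fun _ => l, rfl, rfl, fun r => r.elim0⟩
    rw [tsum_eq_single T]
    · simp
    · refine fun S hS => absurd (SkewTableau.ext' (funext fun r => ?_)) hS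
      rw [Subsingleton.elim (α := Fin 1) r 0]
      exact S.shape_zero
  · have : IsEmpty (SkewTableau ([] : List ℝ≥0).length l m) :=
      ⟨fun T => h (T.shape_last.symm.trans T.shape_zero)⟩
    simp

theorem skewSchur_cons_subtype (x : ℝ≥0) (xs : List ℝ≥0) (l m : YoungDiagram) :
    skewSchur (x :: xs) l m =
      ∑' κ : {κ : YoungDiagram // m.Interlaces κ},
        (x : ℝ≥0∞) ^ (κ.1.card - m.card) * skewSchur xs l κ := by
  refine ((SkewTableau.consEquiv xs.length l m).symm.tsum_eq _).symm.trans ?_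
  rw [ENNReal.tsum_sigma']
  refine tsum_congr fun κ => ?_
  rw [skewSchur, ← ENNReal.tsum_mul_left]
  refine tsum_congr fun T => ?_
  refine (Fin.prod_univ_succ _).trans ?_
  congr 2
  change (T.shape 0).card - m.card = _
  rw [T.shape_zero]

open Classical in
theorem skewSchur_singleton (x : ℝ≥0) (l m : YoungDiagram) :
    skewSchur [x] l m = if m.Interlaces l then (x : ℝ≥0∞) ^ (l.card - m.card) else 0 := by
  simp only [skewSchur_cons_subtype, skewSchur_nil]
  split_ifs with h
  · rw [tsum_eq_single ⟨l, h⟩]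
    · simp
    · rintro ⟨κ, hκ⟩ hne
      rw [if_neg fun e => hne (Subtype.ext e.symm), mul_zero]
  · refine ENNReal.tsum_eq_zero.2 ?_
    rintro ⟨κ, hκ⟩
    rw [if_neg, mul_zero]
    rintro rfl
    exact h hκ

theorem skewSchur_cons (x : ℝ≥0) (xs : List ℝ≥0) (l m : YoungDiagram) :
    skewSchur (x :: xs) l m = ∑' κ, skewSchur [x] κ m * skewSchur xs l κ := by
  classical
  simp only [skewSchur_cons_subtype x xs, skewSchur_singleton, ite_mul, zero_mul]
  exact (ENNReal.tsum_ite_eq_tsum_subtype m.Interlaces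
    fun κ => (x : ℝ≥0∞) ^ (κ.card - m.card) * skewSchur xs l κ).symm

theorem tauSchur_cons (x : ℝ≥0) (xs : List ℝ≥0) (l : YoungDiagram) :
    tauSchur (x :: xs) l = ∑' κ, tauSchur [x] κ * skewSchur xs l κ := by
  simp only [tauSchur, skewSchur_cons x xs, ← ENNReal.tsum_mul_right]
  exact ENNReal.tsum_comm

theorem tauSchur_singleton (x : ℝ≥0) (l : YoungDiagram) :
    tauSchur [x] l = (x : ℝ≥0∞) ^ (l.card - l.evenCore.card) := by
  rw [tauSchur, tsum_eq_single ⟨l.evenCore, l.evenCore_isEven⟩]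
  · rw [skewSchur_singleton, if_pos l.evenCore_interlaces]
  · rintro ⟨κ, hκ⟩ hne
    rw [skewSchur_singleton, if_neg fun h => hne (Subtype.ext (YoungDiagram.eq_evenCore hκ h))]

theorem tauSchur_singleton_bot (x : ℝ≥0) : tauSchur [x] ⊥ = 1 := by
  rw [tauSchur_singleton, YoungDiagram.card_bot, Nat.zero_sub, pow_zero]

theorem skewSchur_singleton_bot (x : ℝ≥0) {m : YoungDiagram} (h : skewSchur [x] ⊥ m ≠ 0) :
    m = ⊥ := by
  classical
  rw [skewSchur_singleton] at h
  exact (ite_ne_right_iff.1 h).1.eq_bot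

/-! ### One-variable Cauchy identities -/

open Classical in
theorem tsum_ite_interlaces (l m : YoungDiagram) (F : YoungDiagram → ℝ≥0∞) :
    ∑' κ, (if l.Interlaces κ ∧ m.Interlaces κ then F κ else 0) =
      ∑' k : ℕ, ∑' ν : {ν : YoungDiagram // ν.Interlaces l ∧ ν.Interlaces m},
        F (YoungDiagram.growth l m ν.1 k ν.2.1 ν.2.2) := by
  calc
    _ = ∑' κ : {κ : YoungDiagram // l.Interlaces κ ∧ m.Interlaces κ}, F κ :=
      ENNReal.tsum_ite_eq_tsum_subtype _ F
    _ = ∑' p, F ((YoungDiagram.growthEquiv l m).symm p) :=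
      ((YoungDiagram.growthEquiv l m).symm.tsum_eq fun κ => F κ.1).symm
    _ = _ := ENNReal.tsum_prod'

/-- The Cauchy identity for one variable on each side, refined by the first row. -/
theorem tsum_skewSchur_mul_skewSchur (x y : ℝ≥0) (l m : YoungDiagram) (φ : ℕ → ℝ≥0∞) :
    ∑' κ, φ (κ.rowLen 0) * (skewSchur [x] κ l * skewSchur [y] κ m) =
      (∑' k, φ (max (l.rowLen 0) (m.rowLen 0) + k) * ((x : ℝ≥0∞) * y) ^ k) *
        ∑' ν, skewSchur [x] m ν * skewSchur [y] l ν := by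
  classical
  have h₁ : ∀ κ, φ (κ.rowLen 0) * (skewSchur [x] κ l * skewSchur [y] κ m) =
      if l.Interlaces κ ∧ m.Interlaces κ then
        φ (κ.rowLen 0) * ((x : ℝ≥0∞) ^ (κ.card - l.card) * (y : ℝ≥0∞) ^ (κ.card - m.card))
      else 0 := by
    intro κ
    rw [skewSchur_singleton, skewSchur_singleton]
    split_ifs <;> simp_all
  have h₂ : ∑' ν, skewSchur [x] m ν * skewSchur [y] l ν =
      ∑' ν : {ν : YoungDiagram // ν.Interlaces l ∧ ν.Interlaces m},
        (x : ℝ≥0∞) ^ (m.card - ν.1.card) * (y : ℝ≥0∞) ^ (l.card - ν.1.card) := by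
    refine Eq.trans (tsum_congr fun ν => ?_) (ENNReal.tsum_ite_eq_tsum_subtype
      (fun ν : YoungDiagram => ν.Interlaces l ∧ ν.Interlaces m)
      fun ν => (x : ℝ≥0∞) ^ (m.card - ν.card) * (y : ℝ≥0∞) ^ (l.card - ν.card))
    rw [skewSchur_singleton, skewSchur_singleton]
    split_ifs <;> simp_all
  rw [tsum_congr h₁, tsum_ite_interlaces, h₂, ← ENNReal.tsum_mul_right]
  refine tsum_congr fun k => ?_
  rw [← ENNReal.tsum_mul_left]
  refine tsum_congr fun ⟨ν, hl, hm⟩ => ?_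
  have := YoungDiagram.card_growth k hl hm
  have := hl.card_le
  have := hm.card_le
  rw [YoungDiagram.rowLen_growth_zero,
    show (YoungDiagram.growth l m ν k hl hm).card - l.card = k + (m.card - ν.card) by omega,
    show (YoungDiagram.growth l m ν k hl hm).card - m.card = k + (l.card - ν.card) by omega]
  ring

/-- The boundary Cauchy identity for one variable, refined by the first row. -/
theorem tsum_tauSchur_mul_skewSchur (c x : ℝ≥0) (m : YoungDiagram) (φ : ℕ → ℝ≥0∞) :
    ∑' κ, φ (κ.rowLen 0) * (tauSchur [c] κ * skewSchur [x] κ m) =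
      (∑' k, φ (m.rowLen 0 + k) * ((c : ℝ≥0∞) * x) ^ k) *
        ∑' ν, tauSchur [c] ν * skewSchur [x] m ν := by
  classical
  have h₁ : ∀ κ, φ (κ.rowLen 0) * (tauSchur [c] κ * skewSchur [x] κ m) =
      if m.Interlaces κ ∧ m.Interlaces κ then
        φ (κ.rowLen 0) * ((c : ℝ≥0∞) ^ (κ.card - κ.evenCore.card) *
          (x : ℝ≥0∞) ^ (κ.card - m.card))
      else 0 := by
    intro κ
    rw [skewSchur_singleton, tauSchur_singleton]
    split_ifs <;> simp_all
  have h₂ : ∑' ν, tauSchur [c] ν * skewSchur [x] m ν =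
      ∑' ν : {ν : YoungDiagram // ν.Interlaces m ∧ ν.Interlaces m},
        (c : ℝ≥0∞) ^ (ν.1.card - ν.1.evenCore.card) * (x : ℝ≥0∞) ^ (m.card - ν.1.card) := by
    refine Eq.trans (tsum_congr fun ν => ?_) (ENNReal.tsum_ite_eq_tsum_subtype
      (fun ν : YoungDiagram => ν.Interlaces m ∧ ν.Interlaces m)
      fun ν => (c : ℝ≥0∞) ^ (ν.card - ν.evenCore.card) * (x : ℝ≥0∞) ^ (m.card - ν.card))
    rw [skewSchur_singleton, tauSchur_singleton]
    split_ifs <;> simp_all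
  rw [tsum_congr h₁, tsum_ite_interlaces, h₂, ← ENNReal.tsum_mul_right]
  refine tsum_congr fun k => ?_
  rw [← ENNReal.tsum_mul_left]
  refine tsum_congr fun ⟨ν, hm, _⟩ => ?_
  have := YoungDiagram.card_growth k hm hm
  have := hm.card_le
  have h₃ := YoungDiagram.altSum_growth k hm
  rw [← YoungDiagram.card_sub_card_evenCore, ← YoungDiagram.card_sub_card_evenCore] at h₃
  rw [YoungDiagram.rowLen_growth_zero, max_self,
    show (YoungDiagram.growth m m ν k hm hm).card - m.card = k + (m.card - ν.card) by omega,
    show (YoungDiagram.growth m m ν k hm hm).card -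
      (YoungDiagram.growth m m ν k hm hm).evenCore.card = k + (ν.card - ν.evenCore.card) by
        exact_mod_cast h₃]
  ring

/-! ### Last passage times: recursion and independence -/

section lastPassage

theorem lastPassage_zero_right (g : ℕ → ℕ → ℕ) (p : ℕ) : lastPassage g p 0 = 0 := by
  rw [lastPassage]

theorem lastPassage_diag (g : ℕ → ℕ → ℕ) (q : ℕ) :
    lastPassage g (q + 1) (q + 1) = g (q + 1) (q + 1) + lastPassage g (q + 1) q := by
  rw [lastPassage, if_neg (by omega)]

theorem lastPassage_off (g : ℕ → ℕ → ℕ) {p q : ℕ} (h : q + 1 ≤ p) :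
    lastPassage g (p + 1) (q + 1) = g (p + 1) (q + 1) +
      max (lastPassage g p (q + 1)) (lastPassage g (p + 1) q) := by
  rw [lastPassage, if_pos h]

theorem lastPassage_induction {C : ℕ → ℕ → Prop} (h₀ : ∀ p, C p 0)
    (hdiag : ∀ q, C (q + 1) q → C (q + 1) (q + 1))
    (hoff : ∀ p q, q + 1 ≤ p → C p (q + 1) → C (p + 1) q → C (p + 1) (q + 1)) :
    ∀ q p, q ≤ p → C p q := by
  intro q
  induction q with
  | zero => exact fun p _ => h₀ p
  | succ q ihq =>
    intro p hp
    induction p, hp using Nat.le_induction with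
    | base => exact hdiag q (ihq _ (Nat.le_succ q))
    | succ p hp ih => exact hoff p q hp ih (ihq _ (by omega))

theorem lastPassage_congr {g g' : ℕ → ℕ → ℕ} {p q : ℕ} (hqp : q ≤ p)
    (h : ∀ p' q', 1 ≤ q' → q' ≤ p' → p' ≤ p → q' ≤ q → g p' q' = g' p' q') :
    lastPassage g p q = lastPassage g' p q := by
  revert h
  refine lastPassage_induction
    (C := fun p q => (∀ p' q', 1 ≤ q' → q' ≤ p' → p' ≤ p → q' ≤ q → g p' q' = g' p' q') →
      lastPassage g p q = lastPassage g' p q)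
    (fun p _ => by rw [lastPassage_zero_right, lastPassage_zero_right]) (fun q ih h => ?_)
    (fun p q hq ih₁ ih₂ h => ?_) q p hqp
  · rw [lastPassage_diag, lastPassage_diag, h _ _ (by omega) le_rfl le_rfl le_rfl,
      ih fun p' q' h₁ h₂ h₃ h₄ => h p' q' h₁ h₂ h₃ (by omega)]
  · rw [lastPassage_off _ hq, lastPassage_off _ hq, h _ _ (by omega) (by omega) le_rfl le_rfl,
      ih₁ fun p' q' h₁ h₂ h₃ h₄ => h p' q' h₁ h₂ (by omega) h₄,
      ih₂ fun p' q' h₁ h₂ h₃ h₄ => h p' q' h₁ h₂ h₃ (by omega)]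

variable {Ω : Type*} [MeasurableSpace Ω] {P : Measure Ω} {g : ℕ → ℕ → Ω → ℕ}

theorem measurable_lastPassage (hg : ∀ p q, 1 ≤ q → q ≤ p → Measurable (g p q)) {p q : ℕ}
    (hqp : q ≤ p) : Measurable fun ω => lastPassage (fun p q => g p q ω) p q := by
  refine lastPassage_induction
    (C := fun p q => Measurable fun ω => lastPassage (fun p q => g p q ω) p q)
    (fun p => ?_) (fun q ih => ?_) (fun p q hq ih₁ ih₂ => ?_) q p hqp
  · simp only [lastPassage_zero_right]; exact measurable_const
  · simp only [lastPassage_diag]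
    exact (hg _ _ (by omega) le_rfl).add ih
  · simp only [lastPassage_off _ hq]
    exact (hg _ _ (by omega) (by omega)).add (ih₁.max ih₂)

/-- Passage times to points which are not above and to the right of `(p, q)` are independent of
the weight at `(p, q)`. -/
theorem indepFun_lastPassage (hg : ∀ p q, 1 ≤ q → q ≤ p → Measurable (g p q))
    (hindep : iIndepFun
      (fun v : {v : ℕ × ℕ // 1 ≤ v.2 ∧ v.2 ≤ v.1} => g v.1.1 v.1.2) P)
    {ι : Type*} [Fintype ι] (x y : ι → ℕ) (hyx : ∀ s, y s ≤ x s) {p q : ℕ} (hq : 1 ≤ q)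
    (hqp : q ≤ p) (h : ∀ s, q ≤ y s → x s < p) :
    IndepFun (fun ω s => lastPassage (fun p q => g p q ω) (x s) (y s)) (g p q) P := by
  classical
  let I := {v : ℕ × ℕ // 1 ≤ v.2 ∧ v.2 ≤ v.1}
  let v₀ : I := ⟨(p, q), hq, hqp⟩
  let B := ∑ s, x s
  have hB : ∀ s, x s ≤ B := fun s => Finset.single_le_sum (fun _ _ => Nat.zero_le _)
    (Finset.mem_univ s)
  -- All weights with coordinates up to B except the one at (p, q). Replacing the weights outside
  -- `S` by 0 in `φ` is harmless, because the passage times in question read none of them.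
  let S : Finset I := ((Finset.range (B + 1) ×ˢ Finset.range (B + 1)).subtype _).erase v₀
  have hdisj : Disjoint S {v₀} := by simp [S]
  have key := hindep.indepFun_finset S {v₀} hdisj (fun v => hg _ _ v.2.1 v.2.2)
  let φ : (S → ℕ) → ι → ℕ := fun z s =>
    lastPassage (fun p q => if hv : ∃ hI, (⟨(p, q), hI⟩ : I) ∈ S then z ⟨_, hv.2⟩ else 0)
      (x s) (y s)
  let ψ : (({v₀} : Finset I) → ℕ) → ℕ := fun z => z ⟨v₀, Finset.mem_singleton_self v₀⟩
  have := key.comp (φ := φ) (ψ := ψ) Measurable.of_discrete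
    Measurable.of_discrete
  refine IndepFun.congr this (Filter.Eventually.of_forall fun ω => funext fun s => Eq.symm ?_)
    Filter.EventuallyEq.rfl
  refine lastPassage_congr (hyx s) fun p' q' h₁ h₂ h₃ h₄ => ?_
  have hv : ∃ hI, (⟨(p', q'), hI⟩ : I) ∈ S := by
    refine ⟨⟨h₁, h₂⟩, Finset.mem_erase.2 ⟨fun he => ?_, ?_⟩⟩
    · have he := congrArg Subtype.val he
      simp only [v₀, Prod.mk.injEq] at he
      have := h s (by omega)
      omega
    · have := hB s
      simp only [Finset.mem_subtype, Finset.mem_product, Finset.mem_range]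
      omega
  rw [dif_pos hv]

/-- Splitting by the value of X and using independence turns the expectation into the weighted sum
over k that the Cauchy identities produce. -/
theorem lintegral_geometric {X : Ω → ℕ} {β : Type*} [MeasurableSpace β] {Y : Ω → β} {x y : ℝ≥0}
    (hX : IsGeometric P X (x * y)) (hxy : x * y < 1) (hY : Measurable Y) (h : IndepFun Y X P)
    (F : ℕ → β → ℝ≥0∞) (hF : ∀ k, Measurable (F k)) :
    ∫⁻ ω, F (X ω) (Y ω) ∂P =
      ENNReal.ofReal (1 - x * y) * ∫⁻ ω, ∑' k, F k (Y ω) * ((x : ℝ≥0∞) * y) ^ k ∂P := by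
  classical
  have h₁ : ∀ ω, F (X ω) (Y ω) = ∑' k, F k (Y ω) * ((X ⁻¹' {k}).indicator 1 ω) := by
    intro ω
    rw [tsum_eq_single (X ω)]
    · simp
    · intro k hk
      simp [Ne.symm hk]
  have hFY : ∀ k, Measurable fun ω => F k (Y ω) := fun k => (hF k).comp hY
  have hm : ∀ k, MeasurableSet (X ⁻¹' {k}) := fun k => hX.1 (measurableSet_singleton k)
  have h₂ : ∀ k, ∫⁻ ω, F k (Y ω) * ((X ⁻¹' {k}).indicator 1 ω) ∂P =
      ENNReal.ofReal (1 - x * y) * ∫⁻ ω, F k (Y ω) * ((x : ℝ≥0∞) * y) ^ k ∂P := by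
    intro k
    have h₃ : IndepFun (fun ω => F k (Y ω)) ((X ⁻¹' {k}).indicator (1 : Ω → ℝ≥0∞)) P :=
      h.comp (φ := F k) (ψ := ({k} : Set ℕ).indicator 1) (hF k) Measurable.of_discrete
    have h₄ := lintegral_mul_eq_lintegral_mul_lintegral_of_indepFun (hFY k)
      (measurable_one.indicator (hm k)) h₃
    have h₅ : (0 : ℝ) ≤ 1 - x * y := sub_nonneg.2 (by exact_mod_cast hxy.le)
    refine h₄.trans ?_
    rw [lintegral_indicator_one (hm k), hX.2 k, lintegral_mul_const _ (hFY k),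
      ENNReal.ofReal_mul h₅, ENNReal.ofReal_pow (by positivity),
      ENNReal.ofReal_mul (by positivity), ENNReal.ofReal_coe_nnreal, ENNReal.ofReal_coe_nnreal]
    ring
  simp only [h₁]
  have hFX : ∀ k, Measurable fun ω => F k (Y ω) * (X ⁻¹' {k}).indicator (1 : Ω → ℝ≥0∞) ω :=
    fun k => (hFY k).mul (measurable_one.indicator (hm k))
  rw [lintegral_tsum fun k => (hFX k).aemeasurable,
    lintegral_tsum fun k => ((hFY k).mul_const _).aemeasurable, ← ENNReal.tsum_mul_left]
  exact tsum_congr h₂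

end lastPassage

/-! ### Weights along a path and pushing in a corner -/

theorem ENNReal.tsum_congr_update {ι Y : Type*} [DecidableEq ι] [Inhabited Y] (t : ι)
    {F F' : (ι → Y) → ℝ≥0∞}
    (h : ∀ x, ∑' y, F (Function.update x t y) = ∑' y, F' (Function.update x t y)) :
    ∑' x, F x = ∑' x, F' x := by
  have key : ∀ F : (ι → Y) → ℝ≥0∞, ∑' x, F x = ∑' r : {j // j ≠ t} → Y, ∑' y,
      F (Function.update ((Equiv.funSplitAt t Y).symm (default, r)) t y) := by
    intro F
    rw [ENNReal.tsum_comm, ← ENNReal.tsum_prod, ← (Equiv.funSplitAt t Y).symm.tsum_eq]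
    refine tsum_congr fun p => congrArg F (funext fun j => ?_)
    by_cases hj : j = t
    · subst hj; simp
    · simp [hj]
  rw [key F, key F']
  exact tsum_congr fun r => h _

theorem Finset.prod_univ_eq_mul_mul {ι M : Type*} [Fintype ι] [DecidableEq ι] [CommMonoid M]
    (f : ι → M) {i j : ι} (h : i ≠ j) :
    ∏ x, f x = f i * f j * ∏ x ∈ ({i, j} : Finset ι)ᶜ, f x := by
  rw [← Finset.prod_pair h, Finset.prod_mul_prod_compl]

/-- The weight of the edge `e` of the path through the points `(M - t + u t, u t)`. -/
noncomputable def heightEdge (a : ℕ → ℝ≥0) {M : ℕ} (u : Fin (M + 1) → ℕ)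
    (lam : Fin (M + 1) → YoungDiagram) (e : Fin M) : ℝ≥0∞ :=
  if u e.succ = u e.castSucc + 1 then skewSchur [a (u e.succ)] (lam e.succ) (lam e.castSucc)
  else skewSchur [a (M - e + u e.castSucc)] (lam e.castSucc) (lam e.succ)

open Classical in
/-- The weight of a family of partitions along the path through the points
`(M - t + u t, u t)`. -/
noncomputable def heightWeight (a : ℕ → ℝ≥0) (c : ℝ≥0) {M : ℕ} (u : Fin (M + 1) → ℕ)
    (lam : Fin (M + 1) → YoungDiagram) : ℝ≥0∞ :=
  (if lam 0 = ⊥ then 1 else 0) * tauSchur [c] (lam (Fin.last M)) * ∏ e, heightEdge a u lam e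

/-- Unit up-steps and level steps starting at height zero. -/
structure IsHeight {M : ℕ} (u : Fin (M + 1) → ℕ) : Prop where
  zero : u 0 = 0
  step : ∀ e : Fin M, u e.succ = u e.castSucc ∨ u e.succ = u e.castSucc + 1

namespace IsHeight

variable {M : ℕ} {u : Fin (M + 1) → ℕ}

theorem monotone (hu : IsHeight u) : Monotone u :=
  Fin.monotone_iff_le_succ.2 fun e => by rcases hu.step e with h | h <;> omega

/-- This says that the first coordinate M - t + u t never increases along the path. -/
theorem antitone_sub (hu : IsHeight u) {s t : Fin (M + 1)} (h : s ≤ t) : u t + s ≤ u s + t := by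
  have : Antitone fun t : Fin (M + 1) => (u t : ℤ) - t :=
    Fin.antitone_iff_succ_le.2 fun e => by
      rcases hu.step e with h | h <;> simp only [Fin.val_succ, Fin.val_castSucc] <;> omega
  have := this h
  simp only at this
  omega

/-- The following step must be level: lowering the vertex turns it into an up-step, whereas a
following up-step would become a jump by two. -/
theorem update (hu : IsHeight u) {e : Fin M} (he : u e.succ = u e.castSucc + 1)
    (h : ∀ e' : Fin M, e'.castSucc = e.succ → u e'.succ = u e'.castSucc) :
    IsHeight (Function.update u e.succ (u e.castSucc)) where
  zero := by rw [Function.update_of_ne (Fin.succ_ne_zero e).symm, hu.zero]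
  step := by
    intro e'
    by_cases h₁ : e' = e
    · subst h₁
      rw [Function.update_self, Function.update_of_ne Fin.castSucc_lt_succ.ne]
      exact Or.inl rfl
    · rw [Function.update_of_ne fun h => h₁ (Fin.succ_injective _ h)]
      by_cases h₂ : e'.castSucc = e.succ
      · rw [h₂, Function.update_self, h e' h₂, h₂, he]
        exact Or.inr rfl
      · rw [Function.update_of_ne h₂]
        exact hu.step e'

end IsHeight

section weights

variable {M : ℕ} {u : Fin (M + 1) → ℕ} (a : ℕ → ℝ≥0) (c : ℝ≥0)

theorem heightEdge_update_update (lam : Fin (M + 1) → YoungDiagram) {v : Fin (M + 1)} {e : Fin M}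
    (h₁ : e.succ ≠ v) (h₂ : e.castSucc ≠ v) (n : ℕ) (κ : YoungDiagram) :
    heightEdge a (Function.update u v n) (Function.update lam v κ) e = heightEdge a u lam e := by
  simp only [heightEdge, Function.update_of_ne h₁, Function.update_of_ne h₂]

theorem heightEdge_update (lam : Fin (M + 1) → YoungDiagram) {v : Fin (M + 1)} {e : Fin M}
    (h₁ : e.succ ≠ v) (h₂ : e.castSucc ≠ v) (κ : YoungDiagram) :
    heightEdge a u (Function.update lam v κ) e = heightEdge a u lam e := by
  simp only [heightEdge, Function.update_of_ne h₁, Function.update_of_ne h₂]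

/-- The first rows of a family of partitions. -/
def firstRows {M : ℕ} (lam : Fin (M + 1) → YoungDiagram) : Fin (M + 1) → ℕ :=
  fun s => (lam s).rowLen 0

theorem firstRows_apply (lam : Fin (M + 1) → YoungDiagram) (s : Fin (M + 1)) :
    firstRows lam s = (lam s).rowLen 0 := rfl

theorem firstRows_update (lam : Fin (M + 1) → YoungDiagram) (v : Fin (M + 1)) (κ : YoungDiagram) :
    firstRows (Function.update lam v κ) = Function.update (firstRows lam) v (κ.rowLen 0) := by
  funext s
  by_cases h : s = v
  · subst h; simp [firstRows_apply]
  · simp [firstRows_apply, h]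

/-- The outer corner "up, then left" becomes the inner corner "left, then up". The two labels trade
places, as in the Cauchy identity, and k plays the weight at the removed corner. -/
theorem tsum_heightWeight_interior {e e₂ : Fin M} (he : u e.succ = u e.castSucc + 1)
    (hv : e₂.castSucc = e.succ) (he₂ : u e₂.succ = u e₂.castSucc)
    (f : (Fin (M + 1) → ℕ) → ℝ≥0∞) :
    ∑' lam, f (firstRows lam) * heightWeight a c u lam =
      ∑' lam, (∑' k, f (Function.update (firstRows lam) e.succ
          (max (firstRows lam e₂.succ) (firstRows lam e.castSucc) + k)) *
            ((a (M - e₂ + u e.succ) : ℝ≥0∞) * a (u e.succ)) ^ k) *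
        heightWeight a c (Function.update u e.succ (u e.castSucc)) lam := by
  have hval : (e₂ : ℕ) = e + 1 := by simpa using congrArg Fin.val hv
  have hne : e ≠ e₂ := by rintro rfl; omega
  have he₂' : ¬ u e₂.succ = u e₂.castSucc + 1 := by omega
  have hM := e₂.2
  have n₁ : e.castSucc ≠ e.succ := Fin.castSucc_lt_succ.ne
  have n₂ : e₂.succ ≠ e.succ := fun h => hne (Fin.succ_injective _ h).symm
  have n₃ : (0 : Fin (M + 1)) ≠ e.succ := (Fin.succ_ne_zero e).symm
  have n₄ : Fin.last M ≠ e.succ := by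
    rw [← hv]; exact (Fin.castSucc_lt_last e₂).ne'
  -- All partitions are frozen except the one at the corner; `R` collects the factors not involving
  -- it.
  refine ENNReal.tsum_congr_update e.succ fun lam => ?_
  set R := (open Classical in if lam 0 = ⊥ then (1 : ℝ≥0∞) else 0) *
    tauSchur [c] (lam (Fin.last M)) * ∏ e' ∈ ({e, e₂} : Finset (Fin M))ᶜ, heightEdge a u lam e'
    with hR
  have hrest : ∀ e' ∈ ({e, e₂} : Finset (Fin M))ᶜ, e'.succ ≠ e.succ ∧ e'.castSucc ≠ e.succ := by
    intro e' h'
    simp only [Finset.mem_compl, Finset.mem_insert, Finset.mem_singleton, not_or] at h'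
    exact ⟨fun h => h'.1 (Fin.succ_injective _ h),
      fun h => h'.2 (Fin.castSucc_injective _ (h.trans hv.symm))⟩
  have h₁ : ∀ κ, heightWeight a c u (Function.update lam e.succ κ) =
      R * (skewSchur [a (M - e₂ + u e.succ)] κ (lam e₂.succ) *
        skewSchur [a (u e.succ)] κ (lam e.castSucc)) := by
    intro κ
    rw [heightWeight, Function.update_of_ne n₃, Function.update_of_ne n₄,
      Finset.prod_univ_eq_mul_mul _ hne,
      Finset.prod_congr rfl fun e' h' => heightEdge_update a lam (hrest e' h').1 (hrest e' h').2 κ]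
    rw [heightEdge, if_pos he, heightEdge, if_neg he₂', hv]
    simp only [Function.update_self, Function.update_of_ne n₁, Function.update_of_ne n₂]
    rw [hR]; ring
  have h₂ : ∀ ν, heightWeight a c (Function.update u e.succ (u e.castSucc))
      (Function.update lam e.succ ν) =
      R * (skewSchur [a (M - e₂ + u e.succ)] (lam e.castSucc) ν *
        skewSchur [a (u e.succ)] (lam e₂.succ) ν) := by
    intro ν
    rw [heightWeight, Function.update_of_ne n₃, Function.update_of_ne n₄,
      Finset.prod_univ_eq_mul_mul _ hne,
      Finset.prod_congr rfl fun e' h' =>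
        heightEdge_update_update a lam (hrest e' h').1 (hrest e' h').2 _ ν]
    have E₁ : heightEdge a (Function.update u e.succ (u e.castSucc)) (Function.update lam e.succ ν) e
        = skewSchur [a (M - e₂ + u e.succ)] (lam e.castSucc) ν := by
      simp only [heightEdge, Function.update_self, Function.update_of_ne n₁]
      -- The left step now starts one unit of time earlier and one unit lower, hence in the same
      -- column and with the same label.
      rw [if_neg (by omega), show M - e + u e.castSucc = M - e₂ + u e.succ by omega]
    have E₂ : heightEdge a (Function.update u e.succ (u e.castSucc)) (Function.update lam e.succ ν)
        e₂ = skewSchur [a (u e.succ)] (lam e₂.succ) ν := by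
      simp only [heightEdge, hv, Function.update_self, Function.update_of_ne n₂]
      rw [if_pos (by rw [he₂, hv, he]), he₂, hv]
    rw [E₁, E₂, hR]
    ring
  simp only [h₁, h₂, firstRows_update, Function.update_idem, Function.update_of_ne n₁,
    Function.update_of_ne n₂]
  have key := tsum_skewSchur_mul_skewSchur (a (M - e₂ + u e.succ)) (a (u e.succ)) (lam e₂.succ)
    (lam e.castSucc) fun n => f (Function.update (firstRows lam) e.succ n)
  rw [ENNReal.tsum_mul_left, ENNReal.tsum_mul_left, mul_left_comm (∑' k, _),
    firstRows_apply, firstRows_apply, ← key, ← ENNReal.tsum_mul_left]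
  exact tsum_congr fun κ => mul_left_comm _ _ _

theorem tsum_heightWeight_boundary {e : Fin M} (he : u e.succ = u e.castSucc + 1)
    (hv : e.succ = Fin.last M) (f : (Fin (M + 1) → ℕ) → ℝ≥0∞) :
    ∑' lam, f (firstRows lam) * heightWeight a c u lam =
      ∑' lam, (∑' k, f (Function.update (firstRows lam) e.succ (firstRows lam e.castSucc + k)) *
            ((c : ℝ≥0∞) * a (u e.succ)) ^ k) *
        heightWeight a c (Function.update u e.succ (u e.castSucc)) lam := by
  have hval : (e : ℕ) + 1 = M := by simpa using congrArg Fin.val hv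
  have n₁ : e.castSucc ≠ e.succ := Fin.castSucc_lt_succ.ne
  have n₃ : (0 : Fin (M + 1)) ≠ e.succ := (Fin.succ_ne_zero e).symm
  refine ENNReal.tsum_congr_update e.succ fun lam => ?_
  set R := (open Classical in if lam 0 = ⊥ then (1 : ℝ≥0∞) else 0) *
    ∏ e' ∈ ({e} : Finset (Fin M))ᶜ, heightEdge a u lam e' with hR
  have hrest : ∀ e' ∈ ({e} : Finset (Fin M))ᶜ, e'.succ ≠ e.succ ∧ e'.castSucc ≠ e.succ := by
    intro e' h'
    simp only [Finset.mem_compl, Finset.mem_singleton] at h'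
    exact ⟨fun h => h' (Fin.succ_injective _ h), fun h => (Fin.castSucc_lt_last e').ne (h.trans hv)⟩
  have h₁ : ∀ κ, heightWeight a c u (Function.update lam e.succ κ) =
      R * (tauSchur [c] κ * skewSchur [a (u e.succ)] κ (lam e.castSucc)) := by
    intro κ
    rw [heightWeight, Function.update_of_ne n₃, ← hv, Function.update_self,
      Fintype.prod_eq_mul_prod_compl e,
      Finset.prod_congr rfl fun e' h' => heightEdge_update a lam (hrest e' h').1 (hrest e' h').2 κ]
    rw [heightEdge, if_pos he, Function.update_self, Function.update_of_ne n₁, hR]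
    ring
  have h₂ : ∀ ν, heightWeight a c (Function.update u e.succ (u e.castSucc))
      (Function.update lam e.succ ν) =
      R * (tauSchur [c] ν * skewSchur [a (u e.succ)] (lam e.castSucc) ν) := by
    intro ν
    rw [heightWeight, Function.update_of_ne n₃, ← hv, Function.update_self,
      Fintype.prod_eq_mul_prod_compl e,
      Finset.prod_congr rfl fun e' h' =>
        heightEdge_update_update a lam (hrest e' h').1 (hrest e' h').2 _ ν]
    have E₁ : heightEdge a (Function.update u e.succ (u e.castSucc)) (Function.update lam e.succ ν) e
        = skewSchur [a (u e.succ)] (lam e.castSucc) ν := by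
      simp only [heightEdge, Function.update_self, Function.update_of_ne n₁]
      rw [if_neg (by omega), show M - e + u e.castSucc = u e.succ by omega]
    rw [E₁, hR]
    ring
  simp only [h₁, h₂, firstRows_update, Function.update_idem, Function.update_of_ne n₁]
  have key := tsum_tauSchur_mul_skewSchur c (a (u e.succ))
    (lam e.castSucc) fun n => f (Function.update (firstRows lam) e.succ n)
  rw [ENNReal.tsum_mul_left, ENNReal.tsum_mul_left, mul_left_comm (∑' k, _),
    firstRows_apply, ← key, ← ENNReal.tsum_mul_left]
  exact tsum_congr fun κ => mul_left_comm _ _ _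

/-- A level edge requires its end partition to lie inside its start partition, so the empty start
forces all the others to be empty. -/
theorem heightWeight_const_zero (lam : Fin (M + 1) → YoungDiagram) [Decidable (lam = ⊥)] :
    heightWeight a c (fun _ => 0) lam = if lam = ⊥ then 1 else 0 := by
  split_ifs with h
  · subst h
    simp [heightWeight, heightEdge, tauSchur_singleton_bot, skewSchur_singleton,
      YoungDiagram.Interlaces.refl]
  · classical
    by_contra hne
    simp only [heightWeight, heightEdge, mul_ne_zero_iff, Finset.prod_ne_zero_iff] at hne
    refine h (funext fun t => ?_)
    induction t using Fin.induction with
    | zero => exact (ite_ne_right_iff.1 hne.1.1).1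
    | succ t ih =>
      have := hne.2 t (Finset.mem_univ _)
      rw [if_neg (by omega), ih] at this
      exact skewSchur_singleton_bot _ this

end weights

/-! ### Passage times along a path and induction on the area -/

/-- The last passage times along the path through the points `(M - t + u t, u t)`. -/
def heightPassage (g : ℕ → ℕ → ℕ) {M : ℕ} (u : Fin (M + 1) → ℕ) (s : Fin (M + 1)) : ℕ :=
  lastPassage g (M - s + u s) (u s)

/-- Geometric input for independence: after the corner is pushed in, vertices at least as high as
the old corner occur strictly later on the path. -/
theorem IsHeight.succ_lt_of_le_update {M : ℕ} {u : Fin (M + 1) → ℕ} (hu : IsHeight u) {e : Fin M}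
    (he : u e.succ = u e.castSucc + 1) {s : Fin (M + 1)}
    (h : u e.succ ≤ Function.update u e.succ (u e.castSucc) s) : e.succ < s := by
  by_contra hs
  rcases eq_or_lt_of_le (not_lt.1 hs) with rfl | hs
  · rw [Function.update_self] at h; omega
  · rw [Function.update_of_ne hs.ne] at h
    have := hu.monotone (Fin.le_castSucc_iff.2 hs)
    omega

theorem heightPassage_update_of_ne (g : ℕ → ℕ → ℕ) {M : ℕ} (u : Fin (M + 1) → ℕ)
    {s v : Fin (M + 1)} (h : s ≠ v) (n : ℕ) :
    heightPassage g (Function.update u v n) s = heightPassage g u s := by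
  simp only [heightPassage, Function.update_of_ne h]

theorem heightPassage_interior (g : ℕ → ℕ → ℕ) {M : ℕ} {u : Fin (M + 1) → ℕ} {e e₂ : Fin M}
    (he : u e.succ = u e.castSucc + 1) (hv : e₂.castSucc = e.succ)
    (he₂ : u e₂.succ = u e₂.castSucc) :
    heightPassage g u =
      Function.update (heightPassage g (Function.update u e.succ (u e.castSucc))) e.succ
        (max (heightPassage g (Function.update u e.succ (u e.castSucc)) e₂.succ)
            (heightPassage g (Function.update u e.succ (u e.castSucc)) e.castSucc) +
          g (M - e₂ + u e.succ) (u e.succ)) := by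
  have hval : (e₂ : ℕ) = e + 1 := by simpa using congrArg Fin.val hv
  have hM := e₂.2
  have n₁ : e.castSucc ≠ e.succ := Fin.castSucc_lt_succ.ne
  have n₂ : e₂.succ ≠ e.succ := fun h => by
    have := congrArg Fin.val (Fin.succ_injective _ h); omega
  funext s
  by_cases hs : s = e.succ
  · subst hs
    rw [Function.update_self, heightPassage_update_of_ne g u n₁, heightPassage_update_of_ne g u n₂,
      add_comm]
    simp only [heightPassage, he₂, hv, he, Fin.val_succ, Fin.val_castSucc, hval]
    obtain ⟨p, hp⟩ : ∃ p, M - (e + 1) = p + 1 := ⟨M - (e + 1) - 1, by omega⟩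
    rw [hp, show M - (e + 1 + 1) + (u e.castSucc + 1) = p + 1 + u e.castSucc by omega,
      show M - e + u e.castSucc = p + 1 + u e.castSucc + 1 by omega, ← add_assoc,
      lastPassage_off g (by omega)]
  · rw [Function.update_of_ne hs, heightPassage_update_of_ne g u hs]

theorem heightPassage_boundary (g : ℕ → ℕ → ℕ) {M : ℕ} {u : Fin (M + 1) → ℕ} {e : Fin M}
    (he : u e.succ = u e.castSucc + 1) (hv : e.succ = Fin.last M) :
    heightPassage g u =
      Function.update (heightPassage g (Function.update u e.succ (u e.castSucc))) e.succ
        (heightPassage g (Function.update u e.succ (u e.castSucc)) e.castSucc +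
          g (u e.succ) (u e.succ)) := by
  have hval : (e : ℕ) + 1 = M := by simpa using congrArg Fin.val hv
  have n₁ : e.castSucc ≠ e.succ := Fin.castSucc_lt_succ.ne
  funext s
  by_cases hs : s = e.succ
  · subst hs
    rw [Function.update_self, heightPassage_update_of_ne g u n₁, add_comm]
    simp only [heightPassage, he, Fin.val_succ, Fin.val_castSucc]
    rw [show M - (e + 1) + (u e.castSucc + 1) = u e.castSucc + 1 by omega,
      show M - e + u e.castSucc = u e.castSucc + 1 by omega, lastPassage_diag]
  · rw [Function.update_of_ne hs, heightPassage_update_of_ne g u hs]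

section

variable {Ω : Type*} [MeasurableSpace Ω] {P : Measure Ω} {a : ℕ → ℝ≥0} {c : ℝ≥0}
  {g : ℕ → ℕ → Ω → ℕ}

theorem measurable_heightPassage (hg : ∀ p q, 1 ≤ q → q ≤ p → Measurable (g p q)) {M : ℕ}
    (u : Fin (M + 1) → ℕ) : Measurable fun ω => heightPassage (fun p q => g p q ω) u :=
  measurable_pi_iff.2 fun _ => measurable_lastPassage hg (Nat.le_add_left _ _)

/-- If the weighted sums along one path arise from those along another by attaching an
independent geometric variable, then proportionality to the law of the passage times is
inherited. -/
theorem tsum_heightWeight_of_update {M : ℕ} {u u' : Fin (M + 1) → ℕ} {x y : ℝ≥0} {X : Ω → ℕ}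
    (hX : IsGeometric P X (x * y)) (hxy : x * y < 1)
    (hg : ∀ p q, 1 ≤ q → q ≤ p → Measurable (g p q))
    (hindep : IndepFun (fun ω => heightPassage (fun p q => g p q ω) u') X P)
    (F : ℕ → (Fin (M + 1) → ℕ) → Fin (M + 1) → ℕ)
    (hF : ∀ ω, heightPassage (fun p q => g p q ω) u =
      F (X ω) (heightPassage (fun p q => g p q ω) u'))
    (hw : ∀ f : (Fin (M + 1) → ℕ) → ℝ≥0∞, ∑' lam, f (firstRows lam) * heightWeight a c u lam =
      ∑' lam, (∑' k, f (F k (firstRows lam)) * ((x : ℝ≥0∞) * y) ^ k) * heightWeight a c u' lam)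
    (ih : ∃ Z : ℝ≥0∞, Z ≠ 0 ∧ Z ≠ ⊤ ∧ ∀ f : (Fin (M + 1) → ℕ) → ℝ≥0∞,
      ∑' lam, f (firstRows lam) * heightWeight a c u' lam =
        Z * ∫⁻ ω, f (heightPassage (fun p q => g p q ω) u') ∂P) :
    ∃ Z : ℝ≥0∞, Z ≠ 0 ∧ Z ≠ ⊤ ∧ ∀ f : (Fin (M + 1) → ℕ) → ℝ≥0∞,
      ∑' lam, f (firstRows lam) * heightWeight a c u lam =
        Z * ∫⁻ ω, f (heightPassage (fun p q => g p q ω) u) ∂P := by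
  obtain ⟨Z, hZ₀, hZ, hf⟩ := ih
  have hr : ENNReal.ofReal (1 - x * y) ≠ 0 := by
    rw [Ne, ENNReal.ofReal_eq_zero, not_le, sub_pos]
    exact_mod_cast hxy
  -- The Cauchy sum carries (xy)^k without the factor 1 - xy of the geometric law, so each move
  -- divides the constant by it.
  refine ⟨Z * (ENNReal.ofReal (1 - x * y))⁻¹,
    mul_ne_zero hZ₀ (ENNReal.inv_ne_zero.2 ENNReal.ofReal_ne_top),
    ENNReal.mul_ne_top hZ (ENNReal.inv_ne_top.2 hr), fun f => ?_⟩
  simp only [hF]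
  rw [lintegral_geometric hX hxy (measurable_heightPassage hg u') hindep (fun k h => f (F k h))
    fun k => Measurable.of_discrete, hw,
    hf fun h => ∑' k, f (F k h) * ((x : ℝ≥0∞) * y) ^ k, mul_assoc, ← mul_assoc _⁻¹,
    ENNReal.inv_mul_cancel hr ENNReal.ofReal_ne_top, one_mul]

/-- The statement ranges over all test functions of the whole path because each move replaces f by a
different function. -/
theorem tsum_heightWeight [IsProbabilityMeasure P]
    (haa : ∀ p q, 1 ≤ q → q < p → a p * a q < 1) (hca : ∀ p, 1 ≤ p → c * a p < 1)
    (hg_off : ∀ p q, 1 ≤ q → q < p → IsGeometric P (g p q) (a p * a q))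
    (hg_diag : ∀ p, 1 ≤ p → IsGeometric P (g p p) (c * a p))
    (hg_indep : iIndepFun
      (fun v : {v : ℕ × ℕ // 1 ≤ v.2 ∧ v.2 ≤ v.1} => g v.1.1 v.1.2) P)
    {M : ℕ} {u : Fin (M + 1) → ℕ} (hu : IsHeight u) :
    ∃ Z : ℝ≥0∞, Z ≠ 0 ∧ Z ≠ ⊤ ∧ ∀ f : (Fin (M + 1) → ℕ) → ℝ≥0∞,
      ∑' lam, f (firstRows lam) * heightWeight a c u lam =
        Z * ∫⁻ ω, f (heightPassage (fun p q => g p q ω) u) ∂P := by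
  classical
  have hg : ∀ p q, 1 ≤ q → q ≤ p → Measurable (g p q) := by
    intro p q hq hqp
    rcases eq_or_lt_of_le hqp with rfl | h
    · exact (hg_diag _ hq).1
    · exact (hg_off _ _ hq h).1
  induction hn : ∑ s, u s using Nat.strong_induction_on generalizing u with
  | _ n IH =>
  subst hn
  by_cases hup : ∃ e : Fin M, u e.succ = u e.castSucc + 1
  -- After the last up-step every step is level, so its endpoint is either an outer corner or the
  -- diagonal point ending the path.
  · obtain ⟨e, he, hmax⟩ := Finset.exists_max_image
      (Finset.univ.filter fun e : Fin M => u e.succ = u e.castSucc + 1) id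
      (hup.imp fun e he => Finset.mem_filter.2 ⟨Finset.mem_univ _, he⟩)
    replace he := (Finset.mem_filter.1 he).2
    replace hmax : ∀ e', e < e' → u e'.succ = u e'.castSucc := fun e' h =>
      (hu.step e').resolve_right fun h' =>
        (hmax e' (Finset.mem_filter.2 ⟨Finset.mem_univ _, h'⟩)).not_gt h
    have hlevel : ∀ e' : Fin M, e'.castSucc = e.succ → u e'.succ = u e'.castSucc := by
      intro e' h
      have := congrArg Fin.val h
      simp only [Fin.val_castSucc, Fin.val_succ] at this
      exact hmax e' (Fin.lt_def.2 (by omega))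
    have hlt : ∑ s, Function.update u e.succ (u e.castSucc) s < ∑ s, u s := by
      refine Finset.sum_lt_sum (fun s _ => ?_) ⟨e.succ, Finset.mem_univ _, ?_⟩
      · by_cases hs : s = e.succ
        · subst hs; rw [Function.update_self]; omega
        · rw [Function.update_of_ne hs]
      · rw [Function.update_self]; omega
    have ih := IH _ hlt (hu.update he hlevel) rfl
    have hq : 1 ≤ u e.succ := by omega
    by_cases hv : e.succ = Fin.last M
    · refine tsum_heightWeight_of_update (hg_diag _ hq) (hca _ hq) hg ?_
        (fun k h => Function.update h e.succ (h e.castSucc + k))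
        (fun ω => heightPassage_boundary _ he hv) (tsum_heightWeight_boundary a c he hv) ih
      -- No vertex of the lowered path reaches the old height: it would have to come after the last
      -- vertex.
      refine indepFun_lastPassage hg hg_indep _ _ (fun s => Nat.le_add_left _ _) hq le_rfl
        fun s hs => ?_
      have := hu.succ_lt_of_le_update he hs
      rw [hv] at this
      exact absurd this (Fin.le_last s).not_gt
    · have hlt : (e : ℕ) + 1 < M := by
        have := Fin.val_lt_last hv
        simpa using this
      obtain ⟨e₂, hv₂⟩ : ∃ e₂ : Fin M, e₂.castSucc = e.succ := ⟨⟨e + 1, hlt⟩, rfl⟩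
      have hval : (e₂ : ℕ) = e + 1 := by simpa using congrArg Fin.val hv₂
      have he₂ := hlevel e₂ hv₂
      have hM := e₂.2
      refine tsum_heightWeight_of_update (hg_off (M - e₂ + u e.succ) _ hq (by omega))
        (haa _ _ hq (by omega)) hg ?_
        (fun k h => Function.update h e.succ (max (h e₂.succ) (h e.castSucc) + k))
        (fun ω => heightPassage_interior _ he hv₂ he₂)
        (tsum_heightWeight_interior a c he hv₂ he₂) ih
      -- Vertices of the lowered path at or above the old corner's height come no earlier than
      -- `e₂.succ`, which is one column to the left of the corner; columns do not increase
      -- afterwards.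
      refine indepFun_lastPassage hg hg_indep _ _ (fun s => Nat.le_add_left _ _) hq (by omega)
        fun s hs => ?_
      have hs := hu.succ_lt_of_le_update he hs
      have h₁ : e₂.succ ≤ s := by
        rw [Fin.lt_def] at hs
        rw [Fin.le_def]
        simp only [Fin.val_succ] at hs ⊢
        omega
      have h₂ := hu.antitone_sub h₁
      have h₃ := s.2
      rw [hv₂] at he₂
      rw [Function.update_of_ne hs.ne']
      simp only [Fin.val_succ] at h₂
      omega
  · have h₀ : u = fun _ => 0 := by
      funext t
      induction t using Fin.induction with
      | zero => exact hu.zero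
      | succ e ih => rw [(hu.step e).resolve_right fun h => hup ⟨e, h⟩, ih]
    subst h₀
    refine ⟨1, one_ne_zero, ENNReal.one_ne_top, fun f => ?_⟩
    have h₁ : ∀ ω, heightPassage (fun p q => g p q ω) (fun _ : Fin (M + 1) => 0) = fun _ => 0 :=
      fun ω => funext fun s => lastPassage_zero_right _ _
    have h₂ : firstRows (⊥ : Fin (M + 1) → YoungDiagram) = fun _ => 0 :=
      funext fun s => YoungDiagram.rowLen_bot 0
    simp only [heightWeight_const_zero, h₁, lintegral_const, measure_univ, mul_one, one_mul]
    rw [tsum_eq_single ⊥ fun lam hlam => by rw [if_neg hlam, mul_zero], if_pos rfl, mul_one, h₂]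

end

/-! ### From weighted sums to laws -/

theorem normalizedMeasure_apply {X : Type*} [MeasurableSpace X] (w : X → ℝ≥0∞) {s : Set X}
    (hs : MeasurableSet s) :
    normalizedMeasure w s = (∑' x, w x)⁻¹ * ∑' x, w x * s.indicator 1 x := by
  simp [normalizedMeasure, Measure.sum_apply _ hs, Measure.dirac_apply' _ hs]

/-- Summing the hypothesis over b identifies the total weight as Z, so the normalisation needs no
separate computation. -/
theorem identDistrib_normalizedMeasure {Ω X β : Type*} [MeasurableSpace Ω] [MeasurableSpace X]
    [MeasurableSpace β] [Countable β] [MeasurableSingletonClass β] {P : Measure Ω}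
    [IsProbabilityMeasure P] {w : X → ℝ≥0∞} {R : X → β} (hR : Measurable R) {G : Ω → β}
    (hG : Measurable G) {Z : ℝ≥0∞} (hZ₀ : Z ≠ 0) (hZ : Z ≠ ⊤)
    (h : ∀ b, ∑' x, w x * (R ⁻¹' {b}).indicator 1 x = Z * P (G ⁻¹' {b})) :
    IsProbabilityMeasure (normalizedMeasure w) ∧ IdentDistrib G R P (normalizedMeasure w) := by
  have htot : ∑' x, w x = Z := by
    calc
      ∑' x, w x = ∑' x, ∑' b, w x * (R ⁻¹' {b}).indicator 1 x := by
        refine tsum_congr fun x => ?_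
        rw [tsum_eq_single (R x) fun b hb => by simp [Ne.symm hb]]
        simp
      _ = ∑' b, Z * P (G ⁻¹' {b}) := by rw [ENNReal.tsum_comm]; exact tsum_congr h
      _ = Z := by
        have := tsum_measure_preimage_singleton (μ := P) (f := G) Set.countable_univ
          fun b _ => hG (measurableSet_singleton b)
        rw [tsum_univ (f := fun b => P (G ⁻¹' {b}))] at this
        rw [ENNReal.tsum_mul_left, this, Set.preimage_univ, measure_univ, mul_one]
  refine ⟨⟨?_⟩, hG.aemeasurable, hR.aemeasurable, Measure.ext_of_singleton fun b => ?_⟩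
  · rw [normalizedMeasure_apply w MeasurableSet.univ]
    simp [htot, ENNReal.inv_mul_cancel hZ₀ hZ]
  · rw [Measure.map_apply hG (measurableSet_singleton b),
      Measure.map_apply hR (measurableSet_singleton b),
      normalizedMeasure_apply w (hR (measurableSet_singleton b)), h, htot, ← mul_assoc,
      ENNReal.inv_mul_cancel hZ₀ hZ, one_mul]

theorem measurable_rowLen (r : ℕ) : Measurable fun l : YoungDiagram => l.rowLen r :=
  measurable_from_top

/-- The marginal of the law along a path at given times. -/
theorem tsum_heightWeight_indicator {Ω : Type*} [MeasurableSpace Ω] {P : Measure Ω}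
    {a : ℕ → ℝ≥0} {c : ℝ≥0} {g : ℕ → ℕ → Ω → ℕ}
    (hg : ∀ p q, 1 ≤ q → q ≤ p → Measurable (g p q)) {M : ℕ} {u : Fin (M + 1) → ℕ} {Z : ℝ≥0∞}
    (hZ : ∀ f : (Fin (M + 1) → ℕ) → ℝ≥0∞,
      ∑' lam, f (firstRows lam) * heightWeight a c u lam =
        Z * ∫⁻ ω, f (heightPassage (fun p q => g p q ω) u) ∂P) {ι : Type*} [Countable ι]
    (t : ι → Fin (M + 1)) (h : ι → ℕ) :
    ∑' lam, heightWeight a c u lam *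
        ((fun lam : Fin (M + 1) → YoungDiagram => fun k => (lam (t k)).rowLen 0) ⁻¹' {h}).indicator
          1 lam =
      Z * P ((fun ω k => heightPassage (fun p q => g p q ω) u (t k)) ⁻¹' {h}) := by
  have key := hZ (({h' | (fun k => h' (t k)) = h} : Set (Fin (M + 1) → ℕ)).indicator 1)
  refine (tsum_congr fun lam => ?_).trans (key.trans ?_)
  · rw [mul_comm]; rfl
  · rw [← lintegral_indicator_one]
    · rfl
    · exact measurable_pi_iff.2 (fun k => (measurable_pi_apply (t k)).comp
        (measurable_heightPassage hg u)) (MeasurableSet.singleton h)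

/-! ### Zig-zag paths as height functions -/

namespace ZigZagPath

variable (γ : ZigZagPath)

/-- The heights of the vertices of a path. -/
def height (s : Fin (γ.len + 1)) : ℕ := (γ.vertex s).2

theorem isHeight_height : IsHeight γ.height where
  zero := γ.start
  step e := by
    rcases γ.step e with h | h
    · exact Or.inl h.2.symm
    · exact Or.inr h.2

/-- First coordinate plus time minus height is constant; the final diagonal vertex shows that the
constant is the length. -/
theorem vertex_fst (s : Fin (γ.len + 1)) : (γ.vertex s).1 = γ.len - s + γ.height s := by
  have key : ∀ s : Fin (γ.len + 1), (γ.vertex s).1 + s = (γ.vertex s).2 + (γ.vertex 0).1 := by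
    intro s
    induction s using Fin.induction with
    | zero => simp [γ.start]
    | succ e ih =>
      simp only [Fin.val_castSucc, Fin.val_succ] at ih ⊢
      rcases γ.step e with h | h <;> omega
  have h₁ := key s
  have h₂ := key (Fin.last _)
  rw [γ.finish, Fin.val_last] at h₂
  have h₃ := s.2
  rw [height]
  simp only at h₂
  omega

/-- Only the first partition is required to be empty in `heightWeight`; at later axis vertices
emptiness is forced by the level edges. -/
theorem weight_eq (a : ℕ → ℝ≥0) (c : ℝ≥0) (lam : Fin (γ.len + 1) → YoungDiagram) :
    γ.weight [c] (γ.label a) lam = heightWeight a c γ.height lam := by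
  have hedge : ∀ e, γ.edgeWeight (γ.label a) lam e = heightEdge a γ.height lam e := by
    intro e
    rw [edgeWeight, label, heightEdge]
    by_cases h : γ.IsUp e
    · have h' : γ.height e.succ = γ.height e.castSucc + 1 := h
      rw [if_pos h, if_pos h, if_pos h']; rfl
    · have h' : ¬ γ.height e.succ = γ.height e.castSucc + 1 := h
      rw [if_neg h, if_neg h, if_neg h', vertex_fst]; rfl
  classical
  simp only [weight, heightWeight, hedge]
  by_cases h : ∀ t, (γ.vertex t).2 = 0 → lam t = ⊥
  · rw [if_pos h, if_pos (h 0 γ.start), one_mul]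
  · rw [if_neg h]
    by_contra hne
    replace hne := Ne.symm hne
    simp only [mul_ne_zero_iff, Finset.prod_ne_zero_iff] at hne
    refine h fun t => ?_
    induction t using Fin.induction with
    | zero => exact fun _ => (ite_ne_right_iff.1 hne.1.1).1
    | succ e ih =>
      intro he
      have h₁ := hne.2 e (Finset.mem_univ _)
      change γ.height e.succ = 0 at he
      rcases γ.isHeight_height.step e with h' | h'
      · rw [heightEdge, if_neg (by omega), ih (h'.symm.trans he)] at h₁
        exact skewSchur_singleton_bot _ h₁
      · omega

end ZigZagPath

/-! ### Sums over chains -/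

section chain

variable {Y : Type*}

theorem ENNReal.tsum_pi_cons {n : ℕ} (F : (Fin (n + 1) → Y) → ℝ≥0∞) :
    ∑' x, F x = ∑' y, ∑' x : Fin n → Y, F (Fin.cons y x) := by
  rw [← ENNReal.tsum_prod, ← (Fin.consEquiv fun _ => Y).tsum_eq]
  rfl

theorem ENNReal.tsum_pi_zero (F : (Fin 0 → Y) → ℝ≥0∞) : ∑' x, F x = F Fin.elim0 := by
  rw [tsum_eq_single Fin.elim0 fun x hx => absurd (Subsingleton.elim _ _) hx]

theorem ENNReal.tsum_pi_prod {n : ℕ} (A : Fin n → Y → ℝ≥0∞) :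
    ∑' x : Fin n → Y, ∏ k, A k (x k) = ∏ k, ∑' y, A k y := by
  induction n with
  | zero => rw [ENNReal.tsum_pi_zero]; simp
  | succ n ih =>
    rw [ENNReal.tsum_pi_cons, Fin.prod_univ_succ, ← ih, ← ENNReal.tsum_mul_right]
    refine tsum_congr fun y => ?_
    rw [← ENNReal.tsum_mul_left]
    exact tsum_congr fun x => by rw [Fin.prod_univ_succ]; rfl

/-- Summation along a chain, starting from its end. -/
theorem ENNReal.tsum_chain_backward {M : ℕ} (K : Fin M → Y → Y → ℝ≥0∞)
    (W : Fin (M + 1) → Y → ℝ≥0∞)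
    (hW : ∀ e y, W e.castSucc y = ∑' z, K e y z * W e.succ z) (A : Y → ℝ≥0∞) :
    ∑' x : Fin (M + 1) → Y,
        A (x 0) * (∏ e, K e (x e.castSucc) (x e.succ)) * W (Fin.last M) (x (Fin.last M)) =
      ∑' y, A y * W 0 y := by
  induction M generalizing A with
  | zero =>
    rw [ENNReal.tsum_pi_cons]
    refine tsum_congr fun y => ?_
    rw [ENNReal.tsum_pi_zero]
    simp
  | succ M ih =>
    rw [ENNReal.tsum_pi_cons]
    refine tsum_congr fun y => ?_
    have := ih (fun e => K e.succ) (fun s => W s.succ) (fun e y => hW e.succ y) (K 0 y)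
    have h₀ : W 0 y = ∑' z, K 0 y z * W 1 z := hW 0 y
    rw [h₀]
    refine Eq.trans ?_ (congrArg (A y * ·) this)
    rw [← ENNReal.tsum_mul_left]
    refine tsum_congr fun x => ?_
    rw [Fin.prod_univ_succ]
    simp only [Fin.cons_zero, Fin.castSucc_zero, Fin.cons_succ, ← Fin.succ_last,
      ← Fin.succ_castSucc]
    ring

/-- Summation along a chain, starting from its beginning. -/
theorem ENNReal.tsum_chain_forward {n : ℕ} (K : Fin n → Y → Y → ℝ≥0∞)
    (V : Fin (n + 1) → Y → ℝ≥0∞)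
    (hV : ∀ k y, V k.succ y = ∑' z, V k.castSucc z * K k z y) (B : Y → ℝ≥0∞) :
    ∑' x : Fin (n + 1) → Y,
        V 0 (x 0) * (∏ k, K k (x k.castSucc) (x k.succ)) * B (x (Fin.last n)) =
      ∑' y, V (Fin.last n) y * B y := by
  induction n with
  | zero =>
    rw [ENNReal.tsum_pi_cons]
    refine tsum_congr fun y => ?_
    rw [ENNReal.tsum_pi_zero]
    simp
  | succ n ih =>
    have := ih (fun k => K k.succ) (fun s => V s.succ) (fun k y => hV k.succ y)
    refine Eq.trans ?_ this
    rw [ENNReal.tsum_pi_cons, ENNReal.tsum_comm]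
    refine tsum_congr fun x => ?_
    have h₁ : V (Fin.succ 0) (x 0) = ∑' z, V 0 z * K 0 z (x 0) := hV 0 (x 0)
    rw [h₁, mul_assoc, ← ENNReal.tsum_mul_right]
    refine tsum_congr fun y => ?_
    rw [Fin.prod_univ_succ]
    simp only [Fin.cons_zero, Fin.castSucc_zero, Fin.cons_succ, ← Fin.succ_last,
      ← Fin.succ_castSucc]
    ring

/-- The recursion runs on the number M - t of remaining steps. -/
theorem exists_backward_recursion (M : ℕ) (K : ℕ → Y → Y → ℝ≥0∞) (B : Y → ℝ≥0∞) :
    ∃ W : ℕ → Y → ℝ≥0∞, W M = B ∧ ∀ t < M, ∀ y, W t y = ∑' z, K t y z * W (t + 1) z := by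
  let F : ℕ → Y → ℝ≥0∞ := fun r =>
    Nat.rec B (fun r f y => ∑' z, K (M - (r + 1)) y z * f z) r
  refine ⟨fun t => F (M - t), by simp [F], fun t ht y => ?_⟩
  obtain ⟨r, hr⟩ : ∃ r, M - t = r + 1 := ⟨M - t - 1, by omega⟩
  simp only [hr, show M - (t + 1) = r by omega]
  change ∑' z, K (M - (r + 1)) y z * F r z = _
  rw [show M - (r + 1) = t by omega]

end chain

/-! ### Merging consecutive edges -/

theorem varsIoc_self (a : ℕ → ℝ≥0) (q : ℕ) : varsIoc a q q = [] := by
  simp [varsIoc]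

theorem varsIoc_cons (a : ℕ → ℝ≥0) {q r : ℕ} (h : q < r) :
    varsIoc a q r = a (q + 1) :: varsIoc a (q + 1) r := by
  rw [varsIoc, List.Ico.eq_cons (by omega)]; rfl

theorem tsum_skewSchur_nil_left (l : YoungDiagram) (f : YoungDiagram → ℝ≥0∞) :
    ∑' z, skewSchur [] z l * f z = f l := by
  classical
  rw [tsum_eq_single l fun z hz => by rw [skewSchur_nil, if_neg hz, zero_mul], skewSchur_nil,
    if_pos rfl, one_mul]

theorem tsum_skewSchur_nil_right (l : YoungDiagram) (f : YoungDiagram → ℝ≥0∞) :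
    ∑' z, skewSchur [] l z * f z = f l := by
  classical
  rw [tsum_eq_single l fun z hz => by rw [skewSchur_nil, if_neg (Ne.symm hz), zero_mul],
    skewSchur_nil, if_pos rfl, one_mul]

/-- Collapsing consecutive vertical edges. -/
theorem skewSchur_collapse_up (a : ℕ → ℝ≥0) (D : ℕ) :
    ∀ (q : ℕ) (f : ℕ → YoungDiagram → ℝ≥0∞),
      (∀ d < D, ∀ y, f d y = ∑' z, skewSchur [a (q + d + 1)] z y * f (d + 1) z) →
      ∀ y, f 0 y = ∑' z, skewSchur (varsIoc a q (q + D)) z y * f D z := by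
  induction D with
  | zero => intro q f _ y; rw [add_zero, varsIoc_self, tsum_skewSchur_nil_left]
  | succ D ih =>
    intro q f hf y
    have h₁ := ih (q + 1) (fun d => f (d + 1)) fun d hd y => by
      rw [hf (d + 1) (by omega), show q + (d + 1) + 1 = q + 1 + d + 1 by ring]
    rw [hf 0 (Nat.succ_pos D), varsIoc_cons a (by omega), show q + (D + 1) = q + 1 + D by ring]
    simp only [zero_add] at h₁ ⊢
    simp only [h₁, skewSchur_cons _ (varsIoc a (q + 1) (q + 1 + D)), ← ENNReal.tsum_mul_left,
      ← ENNReal.tsum_mul_right, add_zero, mul_assoc]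
    exact ENNReal.tsum_comm

/-- Collapsing consecutive horizontal edges. -/
theorem skewSchur_collapse_left (a : ℕ → ℝ≥0) (D : ℕ) :
    ∀ (r : ℕ) (f : ℕ → YoungDiagram → ℝ≥0∞),
      (∀ d < D, ∀ y, f d y = ∑' z, skewSchur [a (r + D - d)] y z * f (d + 1) z) →
      ∀ y, f 0 y = ∑' z, skewSchur (varsIoc a r (r + D)) y z * f D z := by
  induction D with
  | zero => intro q f _ y; rw [add_zero, varsIoc_self, tsum_skewSchur_nil_right]
  | succ D ih =>
    intro r f hf y
    have h₁ := ih (r + 1) f fun d hd y => by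
      rw [hf d (by omega), show r + (D + 1) - d = r + 1 + D - d by omega]
    rw [h₁, varsIoc_cons a (show r < r + (D + 1) by omega),
      show r + (D + 1) = r + 1 + D by ring]
    simp only [hf D (Nat.lt_succ_self D), skewSchur_cons _ (varsIoc a (r + 1) (r + 1 + D)),
      ← ENNReal.tsum_mul_left, ← ENNReal.tsum_mul_right]
    rw [ENNReal.tsum_comm]
    refine tsum_congr fun z => tsum_congr fun x => ?_
    rw [show r + (D + 1) - D = r + 1 by omega]
    ring

/-! ### The path with prescribed corners -/

section cornerHeight

variable {n : ℕ} {i j : Fin (n + 1) → ℕ}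

/-- The height at time `t` of the path from `(i_n, 0)` to the diagonal which has its outer corners
at the points `(i_k, j_k)`. -/
def cornerHeight (i j : Fin (n + 1) → ℕ) (t : ℕ) : ℕ :=
  Finset.univ.sup fun k => min (j k) (t + i k - i (Fin.last n))

/-- The time at which the path passes through `(i_k, j_k)`. -/
def cornerTime (i j : Fin (n + 1) → ℕ) (k : Fin (n + 1)) : ℕ := i (Fin.last n) - i k + j k

theorem cornerHeight_eq {t : ℕ} (k : Fin (n + 1))
    (h : ∀ k', min (j k') (t + i k' - i (Fin.last n)) ≤ min (j k) (t + i k - i (Fin.last n))) :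
    cornerHeight i j t = min (j k) (t + i k - i (Fin.last n)) :=
  le_antisymm (Finset.sup_le fun k' _ => h k')
    (Finset.le_sup (f := fun k => min (j k) (t + i k - i (Fin.last n))) (Finset.mem_univ k))

theorem isHeight_cornerHeight (hi : StrictMono i) :
    IsHeight (fun s : Fin (i (Fin.last n) + 1) => cornerHeight i j s) where
  zero := by
    refine Nat.eq_zero_of_le_zero (Finset.sup_le fun k _ => ?_)
    have := hi.monotone (Fin.le_last k)
    simp only [Fin.val_zero]
    omega
  step e := by
    have h₁ : cornerHeight i j e ≤ cornerHeight i j (e + 1) :=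
      Finset.sup_mono_fun fun k _ => by omega
    have h₂ : cornerHeight i j (e + 1) ≤ cornerHeight i j e + 1 := by
      refine Finset.sup_le fun k _ => ?_
      have : min (j k) (e + i k - i (Fin.last n)) ≤ cornerHeight i j e :=
        Finset.le_sup (f := fun k => min (j k) (e + i k - i (Fin.last n))) (Finset.mem_univ k)
      omega
    simp only [Fin.val_succ, Fin.val_castSucc]
    omega

theorem cornerTime_le (hi : StrictMono i) (hij : ∀ k, j k ≤ i k) (k : Fin (n + 1)) :
    cornerTime i j k ≤ i (Fin.last n) := by
  have := hi.monotone (Fin.le_last k)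
  have := hij k
  rw [cornerTime]; omega

/-- Time runs from the axis to the diagonal, whereas k counts corners from the diagonal outwards. -/
theorem cornerTime_strictAnti (hi : StrictMono i) (hj : StrictAnti j) :
    StrictAnti (cornerTime i j) := by
  intro k k' h
  have := hi h
  have := hj h
  have := hi.monotone (Fin.le_last k')
  simp only [cornerTime]; omega

theorem cornerHeight_level_last (hj : StrictAnti j) {t : ℕ} (ht : cornerTime i j 0 ≤ t) :
    cornerHeight i j t = j 0 := by
  have h₀ : i (Fin.last n) - i 0 + j 0 ≤ t := ht
  rw [cornerHeight_eq 0 fun k' => ?_]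
  · omega
  · have := hj.antitone (Fin.zero_le k')
    omega

/-- The horizontal segment leaving corner k + 1, down to the inner corner (i_k, j_{k+1}). -/
theorem cornerHeight_level (hi : StrictMono i) (hj : StrictAnti j) (k : Fin n) {t : ℕ}
    (h₁ : cornerTime i j k.succ ≤ t)
    (h₂ : t ≤ i (Fin.last n) - i k.castSucc + j k.succ) : cornerHeight i j t = j k.succ := by
  have h₀ : i (Fin.last n) - i k.succ + j k.succ ≤ t := h₁
  have h₃ := hi.monotone (Fin.le_last k.castSucc)
  rw [cornerHeight_eq k.succ fun k' => ?_]
  · omega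
  · rcases lt_or_ge k' k.succ with h | h
    · have := hi.monotone (Fin.le_castSucc_iff.2 h)
      omega
    · have := hj.antitone h
      omega

/-- The vertical segment from the inner corner (i_k, j_{k+1}) up to (i_k, j_k). -/
theorem cornerHeight_up (hi : StrictMono i) (hj : StrictAnti j) (k : Fin n) {d : ℕ}
    (hd : d ≤ j k.castSucc - j k.succ) :
    cornerHeight i j (i (Fin.last n) - i k.castSucc + j k.succ + d) = j k.succ + d := by
  have h₀ := hj (Fin.castSucc_lt_succ (i := k))
  have h₃ := hi.monotone (Fin.le_last k.castSucc)
  rw [cornerHeight_eq k.castSucc fun k' => ?_]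
  · omega
  · rcases lt_or_ge k' k.succ with h | h
    · have := hi.monotone (Fin.le_castSucc_iff.2 h)
      have := hj.antitone (Fin.le_castSucc_iff.2 h)
      omega
    · have := hj.antitone h
      omega

theorem cornerHeight_up_first (hi : StrictMono i) {d : ℕ} (hd : d ≤ j (Fin.last n)) :
    cornerHeight i j d = d := by
  rw [cornerHeight_eq (Fin.last n) fun k' => ?_]
  · omega
  · have := hi.monotone (Fin.le_last k')
    omega

theorem cornerHeight_cornerTime (hi : StrictMono i) (hj : StrictAnti j) (k : Fin (n + 1)) :
    cornerHeight i j (cornerTime i j k) = j k := by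
  refine Fin.cases (cornerHeight_level_last hj le_rfl) (fun k => ?_) k
  refine cornerHeight_level hi hj k le_rfl ?_
  have := hi (Fin.castSucc_lt_succ (i := k))
  rw [cornerTime]; omega

theorem cornerTime_ne_of_between (hi : StrictMono i) (hj : StrictAnti j) (k : Fin n) {t : ℕ}
    (h₁ : cornerTime i j k.succ < t) (h₂ : t < cornerTime i j k.castSucc) (k' : Fin (n + 1)) :
    cornerTime i j k' ≠ t := by
  have hT := (cornerTime_strictAnti hi hj).antitone
  rcases lt_or_ge k' k.succ with h | h
  · have := hT (Fin.le_castSucc_iff.2 h); omega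
  · have := hT h; omega

end cornerHeight

/-! ### Comparing the two Pfaffian Schur processes -/

/-- The Pfaffian Schur process as a marginal of the process along a path. -/
theorem tsum_pfaffianSchurWeight (a : ℕ → ℝ≥0) (c : ℝ≥0) {n : ℕ} {i j : Fin (n + 1) → ℕ}
    (hi : StrictMono i) (hj : StrictAnti j) (hij : ∀ k, j k ≤ i k) (h : Fin (n + 1) → ℕ) :
    ∑' s, pfaffianSchurWeight (lppRhoPlus a c i j) (lppRhoMinus a j) s *
        ((fun (s : (Fin (n + 1) → YoungDiagram) × (Fin n → YoungDiagram)) (k : Fin (n + 1)) =>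
          (s.1 k).rowLen 0) ⁻¹' {h}).indicator 1 s =
      ∑' lam, heightWeight a c (fun s : Fin (i (Fin.last n) + 1) => cornerHeight i j s) lam *
        ((fun (lam : Fin (i (Fin.last n) + 1) → YoungDiagram) k =>
          (lam ⟨cornerTime i j k, Nat.lt_succ_of_le (cornerTime_le hi hij k)⟩).rowLen 0) ⁻¹'
            {h}).indicator 1 lam := by
  classical
  set M := i (Fin.last n) with hM
  let T := cornerTime i j
  let t : Fin (n + 1) → Fin (M + 1) := fun k =>
    ⟨cornerTime i j k, Nat.lt_succ_of_le (cornerTime_le hi hij k)⟩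
  let φ : Fin (n + 1) → YoungDiagram → ℝ≥0∞ := fun k y => if y.rowLen 0 = h k then 1 else 0
  have hφ : ∀ x : Fin (n + 1) → YoungDiagram, ∏ k, φ k (x k) =
      ({h} : Set (Fin (n + 1) → ℕ)).indicator 1 (fun k => (x k).rowLen 0) := by
    intro x
    rw [Fintype.prod_boole]
    by_cases hx : ∀ k, (x k).rowLen 0 = h k
    · rw [if_pos hx, Set.indicator_of_mem (Set.mem_singleton_iff.2 (funext hx))]; rfl
    · rw [if_neg hx, Set.indicator_of_notMem fun e => hx (congrFun (Set.mem_singleton_iff.1 e))]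
  -- The observation made at time s: trivial except at corner times, where injectivity of `T` leaves
  -- exactly one factor.
  let Φ : ℕ → YoungDiagram → ℝ≥0∞ := fun s y => ∏ k, if T k = s then φ k y else 1
  have hΦ_one : ∀ s y, (∀ k, T k ≠ s) → Φ s y = 1 := fun s y hs =>
    Finset.prod_eq_one fun k _ => if_neg (hs k)
  have hΦ_T : ∀ k y, Φ (T k) y = φ k y := by
    intro k y
    refine (Finset.prod_eq_single k (fun k' _ hk' => if_neg fun e => hk' ?_) (by simp)).trans
      (if_pos rfl)
    exact (cornerTime_strictAnti hi hj).injective e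
  let K : ℕ → YoungDiagram → YoungDiagram → ℝ≥0∞ := fun s y z =>
    if cornerHeight i j (s + 1) = cornerHeight i j s + 1 then
      skewSchur [a (cornerHeight i j (s + 1))] z y
    else skewSchur [a (M - s + cornerHeight i j s)] y z
  -- `W s y` sums over all continuations after time s from y. It includes the observations at later
  -- times but not the one at s itself.
  obtain ⟨W, hWM, hW⟩ := exists_backward_recursion M (fun s y z => K s y z * Φ (s + 1) z)
    (tauSchur [c])
  have hiM : ∀ k, i k ≤ M := fun k => hi.monotone (Fin.le_last k)
  have hlevel : ∀ s q y z, cornerHeight i j s = q → cornerHeight i j (s + 1) = q →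
      K s y z = skewSchur [a (M - s + q)] y z := by
    intro s q y z h₁ h₂
    simp only [K, h₁, h₂]
    rw [if_neg (by omega)]
  have hup : ∀ s q y z, cornerHeight i j s = q → cornerHeight i j (s + 1) = q + 1 →
      K s y z = skewSchur [a (q + 1)] z y := by
    intro s q y z h₁ h₂
    simp only [K, h₁, h₂, if_true]
  -- From the corner nearest the diagonal only left steps remain, and their variables join c in
  -- ρ⁺_0.
  have block_last : ∀ y, W (T 0) y = tauSchur (c :: varsIoc a (j 0) (i 0)) y := by
    intro y
    have h₀ := hij 0
    have h₁ := hiM 0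
    have hT₀ : T 0 + (i 0 - j 0) = M := by simp only [T, cornerTime]; omega
    have key := skewSchur_collapse_left a (i 0 - j 0) (j 0) (fun d => W (T 0 + d))
      (fun d hd y => by
        rw [hW (T 0 + d) (by omega)]
        refine tsum_congr fun z => ?_
        rw [hlevel _ (j 0) _ _ (cornerHeight_level_last hj (by simp [T]))
            (cornerHeight_level_last hj (by simp only [T]; omega)), hΦ_one _ _ fun k' => ?_, mul_one,
          show M - (T 0 + d) + j 0 = j 0 + (i 0 - j 0) - d by omega]
        · rfl
        · have := (cornerTime_strictAnti hi hj).antitone (Fin.zero_le k')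
          simp only [T]; omega) y
    simp only [add_zero, hT₀, hWM] at key
    rw [key, tauSchur_cons, show j 0 + (i 0 - j 0) = i 0 by omega]
    exact tsum_congr fun z => mul_comm _ _
  have block : ∀ (k : Fin n) y, W (T k.succ) y =
      ∑' m, skewSchur (varsIoc a (i k.castSucc) (i k.succ)) y m *
        ∑' z, skewSchur (varsIoc a (j k.succ) (j k.castSucc)) z m *
          (φ k.castSucc z * W (T k.castSucc) z) := by
    intro k y
    have hk := Fin.castSucc_lt_succ (i := k)
    have h₀ := hij k.castSucc
    have h₁ := hiM k.castSucc
    have h₂ := hiM k.succ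
    have h₃ := hi hk
    have h₄ := hj hk
    set C := M - i k.castSucc + j k.succ with hC
    have hT₁ : T k.succ + (i k.succ - i k.castSucc) = C := by
      simp only [T, cornerTime]; omega
    have hT₂ : C + (j k.castSucc - j k.succ) = T k.castSucc := by
      simp only [T, cornerTime]; omega
    have hT₃ : T k.succ = M - i k.succ + j k.succ := rfl
    have key₁ := skewSchur_collapse_left a (i k.succ - i k.castSucc) (i k.castSucc)
      (fun d => W (T k.succ + d))
      (fun d hd y => by
        rw [hW (T k.succ + d) (by omega)]
        refine tsum_congr fun z => ?_
        rw [hlevel _ (j k.succ) _ _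
            (cornerHeight_level hi hj k (by simp [T]) (by omega))
            (cornerHeight_level hi hj k (by simp only [T]; omega) (by omega)),
          hΦ_one _ _ (cornerTime_ne_of_between hi hj k (by simp only [T]; omega)
            (show _ < T k.castSucc by omega)), mul_one,
          show M - (T k.succ + d) + j k.succ =
            i k.castSucc + (i k.succ - i k.castSucc) - d by omega]
        rfl) y
    -- Including `Φ` makes the collapse end with the observation at the next corner; strictness of i
    -- and j keeps the inner corner time C free of observations.
    have key₂ := skewSchur_collapse_up a (j k.castSucc - j k.succ) (j k.succ)
      (fun d y => Φ (C + d) y * W (C + d) y)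
      (fun d hd y => by
        rw [hΦ_one _ _ (cornerTime_ne_of_between hi hj k (show T k.succ < _ by omega)
            (show _ < T k.castSucc by omega)), one_mul, hW _ (by omega)]
        refine tsum_congr fun z => ?_
        rw [hup _ (j k.succ + d) _ _ (cornerHeight_up hi hj k (by omega))
          (cornerHeight_up hi hj k (d := d + 1) (by omega)), mul_assoc]
        rfl)
    simp only [add_zero, hT₁] at key₁
    rw [key₁, show i k.castSucc + (i k.succ - i k.castSucc) = i k.succ by omega]
    refine tsum_congr fun m => ?_
    have key₃ := key₂ m
    simp only [add_zero, hT₂, hΦ_T] at key₃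
    rw [hΦ_one _ _ (cornerTime_ne_of_between hi hj k (show T k.succ < _ by omega)
      (show _ < T k.castSucc by omega)), one_mul] at key₃
    rw [key₃, show j k.succ + (j k.castSucc - j k.succ) = j k.castSucc by omega]
  -- The factor `Φ 0` matters when the last j is 0: the outermost corner is then the starting
  -- vertex.
  have block_first : Φ 0 ⊥ * W 0 ⊥ = ∑' z, skewSchur (varsIoc a 0 (j (Fin.last n))) z ⊥ *
      (φ (Fin.last n) z * W (T (Fin.last n)) z) := by
    have hT : T (Fin.last n) = j (Fin.last n) := by simp [T, cornerTime]
    have hTle : ∀ k, j (Fin.last n) ≤ T k := fun k =>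
      hT ▸ (cornerTime_strictAnti hi hj).antitone (Fin.le_last k)
    have h₀ := hij (Fin.last n)
    have key := skewSchur_collapse_up a (j (Fin.last n)) 0 (fun d y => Φ d y * W d y)
      (fun d hd y => by
        rw [hΦ_one _ _ fun k => by have := hTle k; omega, one_mul, hW _ (by omega)]
        refine tsum_congr fun z => ?_
        rw [hup _ d _ _ (cornerHeight_up_first hi (by omega))
          (cornerHeight_up_first hi (by omega)), mul_assoc, zero_add]) ⊥
    simp only [zero_add] at key
    rw [key]
    refine tsum_congr fun z => ?_
    rw [← hΦ_T, hT]
  have lhs : ∀ lam : Fin (n + 1) → YoungDiagram, ∑' mu : Fin n → YoungDiagram,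
      pfaffianSchurWeight (lppRhoPlus a c i j) (lppRhoMinus a j) (lam, mu) *
        ((fun (s : (Fin (n + 1) → YoungDiagram) × (Fin n → YoungDiagram)) (k : Fin (n + 1)) =>
          (s.1 k).rowLen 0) ⁻¹' {h}).indicator 1 (lam, mu) =
      (φ 0 (lam 0) * W (T 0) (lam 0)) * (∏ k : Fin n, φ k.succ (lam k.succ) *
        ∑' m, skewSchur (varsIoc a (j k.succ) (j k.castSucc)) (lam k.castSucc) m *
          skewSchur (varsIoc a (i k.castSucc) (i k.succ)) (lam k.succ) m) *
        skewSchur (varsIoc a 0 (j (Fin.last n))) (lam (Fin.last n)) ⊥ := by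
    intro lam
    have hind : ∀ mu : Fin n → YoungDiagram,
        ((fun (s : (Fin (n + 1) → YoungDiagram) × (Fin n → YoungDiagram)) (k : Fin (n + 1)) =>
          (s.1 k).rowLen 0) ⁻¹' {h}).indicator 
          (1 : (Fin (n + 1) → YoungDiagram) × (Fin n → YoungDiagram) → ℝ≥0∞) (lam, mu) = ∏ k, φ k (lam k) := by
      intro mu
      rw [hφ]
      rfl
    simp only [hind, pfaffianSchurWeight, lppRhoPlus, lppRhoMinus, Fin.cons_zero, Fin.cons_succ,
      Fin.snoc_castSucc, Fin.snoc_last]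
    rw [ENNReal.tsum_mul_right, ENNReal.tsum_mul_right, ENNReal.tsum_mul_left,
      ENNReal.tsum_pi_prod (fun k m =>
        skewSchur (varsIoc a (j k.succ) (j k.castSucc)) (lam k.castSucc) m *
          skewSchur (varsIoc a (i k.castSucc) (i k.succ)) (lam k.succ) m),
      Finset.prod_mul_distrib, Fin.prod_univ_succ (fun k => φ k (lam k)), block_last]
    ring
  have rhs : ∀ lam : Fin (M + 1) → YoungDiagram,
      heightWeight a c (fun s : Fin (M + 1) => cornerHeight i j s) lam *
        ((fun (lam : Fin (M + 1) → YoungDiagram) k => (lam (t k)).rowLen 0) ⁻¹'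
            {h}).indicator 1 lam =
      ((if lam 0 = ⊥ then 1 else 0) * Φ 0 (lam 0)) *
        (∏ e : Fin M, K e (lam e.castSucc) (lam e.succ) * Φ (e + 1) (lam e.succ)) *
        W (Fin.last M) (lam (Fin.last M)) := by
    intro lam
    have hind : ((fun (lam : Fin (M + 1) → YoungDiagram) k => (lam (t k)).rowLen 0) ⁻¹'
        {h}).indicator (1 : (Fin (M + 1) → YoungDiagram) → ℝ≥0∞) lam = ∏ s : Fin (M + 1), Φ s (lam s) := by
      rw [Finset.prod_comm]
      have : ∀ k, ∏ s : Fin (M + 1), (if T k = s then φ k (lam s) else 1) = φ k (lam (t k)) := by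
        intro k
        refine (Finset.prod_eq_single (t k) (fun s _ hs => if_neg fun e => hs ?_) (by simp)).trans
          (if_pos rfl)
        exact Fin.ext e.symm
      simp only [this]
      rw [hφ fun k => lam (t k)]
      rfl
    rw [hind, Fin.prod_univ_succ, heightWeight, Fin.val_last, hWM, Finset.prod_mul_distrib]
    have hedge : ∀ e : Fin M, heightEdge a (fun s : Fin (M + 1) => cornerHeight i j s) lam e =
        K e (lam e.castSucc) (lam e.succ) := fun e => rfl
    simp only [hedge, Fin.val_succ, Fin.val_zero]
    ring
  rw [ENNReal.tsum_prod']
  refine ((tsum_congr lhs).trans ?_).trans (tsum_congr rhs).symm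
  -- Both sides reduce to `Φ 0 ⊥ * W 0 ⊥`: the path sum is evaluated backwards in time, and the
  -- λ-chain forwards in k, which is the same direction.
  rw [ENNReal.tsum_chain_forward
      (fun (k : Fin n) z y => φ k.succ y *
        ∑' m, skewSchur (varsIoc a (j k.succ) (j k.castSucc)) z m *
          skewSchur (varsIoc a (i k.castSucc) (i k.succ)) y m)
      (fun k y => φ k y * W (T k) y) (fun k y => ?_)
      (fun y => skewSchur (varsIoc a 0 (j (Fin.last n))) y ⊥),
    ENNReal.tsum_chain_backward
      (fun (e : Fin M) y z => K e y z * Φ (e + 1) z) (fun s => W s)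
      (fun e y => hW e e.2 y) (fun y => (if y = ⊥ then 1 else 0) * Φ 0 y)]
  · calc
      _ = Φ 0 ⊥ * W 0 ⊥ := by rw [block_first]; exact tsum_congr fun z => mul_comm _ _
      _ = _ := by
        rw [tsum_eq_single ⊥ fun y hy => by rw [if_neg hy, zero_mul, zero_mul], if_pos rfl,
          one_mul]
        rfl
  · simp only [block, ← ENNReal.tsum_mul_left]
    rw [ENNReal.tsum_comm]
    refine tsum_congr fun z => tsum_congr fun m => ?_
    ring

/-! ### The proposition -/

theorem mainTheorem9
    {Ω : Type*} [MeasurableSpace Ω] (P : Measure Ω) [IsProbabilityMeasure P]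
    (a : ℕ → ℝ≥0) (c : ℝ≥0)
    (ha : ∀ p, 1 ≤ p → 0 < a p) (hc : 0 < c)
    (haa : ∀ p q, 1 ≤ q → q < p → a p * a q < 1) (hca : ∀ p, 1 ≤ p → c * a p < 1)
    (g : ℕ → ℕ → Ω → ℕ)
    (hg_off : ∀ p q, 1 ≤ q → q < p → IsGeometric P (g p q) (a p * a q))
    (hg_diag : ∀ p, 1 ≤ p → IsGeometric P (g p p) (c * a p))
    (hg_indep : iIndepFun
      (fun v : {v : ℕ × ℕ // 1 ≤ v.2 ∧ v.2 ≤ v.1} => g v.1.1 v.1.2) P)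
    (n : ℕ) (i j : Fin (n + 1) → ℕ)
    (hi_pos : 0 < i 0) (hi : StrictMono i) (hj : StrictAnti j) (hij : ∀ k, j k ≤ i k) :
    (IsProbabilityMeasure (pfaffianSchurLaw (lppRhoPlus a c i j) (lppRhoMinus a j)) ∧
      IdentDistrib
        (fun ω (k : Fin (n + 1)) => lastPassage (fun p q => g p q ω) (i k) (j k))
        (fun (s : (Fin (n + 1) → YoungDiagram) × (Fin n → YoungDiagram)) (k : Fin (n + 1)) =>
          (s.1 k).rowLen 0)
        P (pfaffianSchurLaw (lppRhoPlus a c i j) (lppRhoMinus a j))) ∧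
    (∀ (γ : ZigZagPath) (t : Fin (n + 1) → Fin (γ.len + 1)),
      (∀ k, γ.vertex (t k) = (i k, j k)) →
      IsProbabilityMeasure (γ.pfaffianSchurLaw [c] (γ.label a)) ∧
      IdentDistrib
        (fun ω (k : Fin (n + 1)) => lastPassage (fun p q => g p q ω) (i k) (j k))
        (fun (lam : Fin (γ.len + 1) → YoungDiagram) (k : Fin (n + 1)) => (lam (t k)).rowLen 0)
        P (γ.pfaffianSchurLaw [c] (γ.label a))) := by
  have hg : ∀ p q, 1 ≤ q → q ≤ p → Measurable (g p q) := by
    intro p q hq hqp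
    rcases eq_or_lt_of_le hqp with rfl | h
    · exact (hg_diag _ hq).1
    · exact (hg_off _ _ hq h).1
  have hG : Measurable
      fun ω (k : Fin (n + 1)) => lastPassage (fun p q => g p q ω) (i k) (j k) :=
    measurable_pi_iff.2 fun k => measurable_lastPassage hg (hij k)
  refine ⟨?_, fun γ t ht => ?_⟩
  · obtain ⟨Z, hZ₀, hZ, hf⟩ := tsum_heightWeight (P := P) haa hca hg_off hg_diag hg_indep
      (isHeight_cornerHeight (j := j) hi)
    have hR : Measurable fun (s : (Fin (n + 1) → YoungDiagram) × (Fin n → YoungDiagram))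
        (k : Fin (n + 1)) => (s.1 k).rowLen 0 :=
      measurable_pi_iff.2 fun k =>
        (measurable_rowLen 0).comp ((measurable_pi_apply k).comp measurable_fst)
    refine identDistrib_normalizedMeasure hR hG hZ₀ hZ fun h => ?_
    rw [tsum_pfaffianSchurWeight a c hi hj hij h, tsum_heightWeight_indicator hg hf]
    congr 3
    funext ω k
    have h₁ := hi.monotone (Fin.le_last k)
    have h₂ := hij k
    simp only [heightPassage, cornerHeight_cornerTime hi hj]
    rw [show i (Fin.last n) - cornerTime i j k + j k = i k by rw [cornerTime]; omega]
  · obtain ⟨Z, hZ₀, hZ, hf⟩ := tsum_heightWeight (P := P) haa hca hg_off hg_diag hg_indep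
      γ.isHeight_height
    have hR : Measurable fun (lam : Fin (γ.len + 1) → YoungDiagram) (k : Fin (n + 1)) =>
        (lam (t k)).rowLen 0 :=
      measurable_pi_iff.2 fun k => (measurable_rowLen 0).comp (measurable_pi_apply (t k))
    refine identDistrib_normalizedMeasure hR hG hZ₀ hZ fun h => ?_
    simp only [γ.weight_eq]
    rw [tsum_heightWeight_indicator hg hf]
    congr 3
    funext ω k
    have h₁ := γ.vertex_fst (t k)
    simp only [heightPassage]
    rw [← h₁, ZigZagPath.height, ht k]
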